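/- Let $0<p\le 1$. For a metric space $X$, $\mathcal F_p(X)$ denotes the Lipschitz free $p$-space over $X$: the completion of the space of finitely supported $\mu\colon X\to\mathbb R$ with $\sum_x\mu(x)=0$ under $\|\mu\|=\sup\|\sum_x \mu(x)f(x)\|_Y$, the supremum being over all $p$-normed spaces $Y$ and all $1$-Lipschitz maps $f\colon X\to Y$ (so $\mathcal F_p(X)=\{0\}$ if $X$ has at most one point). $(\bigoplus_n X_n)_p$ is the $\ell_p$-sum, $\ell_p(X)$ is the $\ell_p$-sum of countably infinitely many copies of $X$, and $\simeq$ means linear isomorphism (bounded with bounded inverse). Let $(\mathcal M,d,0)$ be a pointed metric space that is doubling (for some $D\in\mathbb N$ every ball of radius $r>0$ can be covered by at most $D$ balls of radius $r/2$) and $R$-closed for some $R\in(0,1)\cup(1,\infty)$, i.e. there is a map $f\colon\mathcal M\to\mathcal M$ with $f(0)=0$ and $d(f(x),f(y))=R\,d(x,y)$ for all $x,y\in\mathcal M$. Put $B_{\mathcal M}=\{x\in\mathcal M: d(0,x)\le 1\}$ and $\mathcal M_{(a,b]}=\{x\in\mathcal M: a<d(0,x)\le b\}$. Let $N$ be a countable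 set and let $\phi\colon N\to\{0,1,2,\dots\}$ be unbounded. Then: (i) If $R>1$, then for every $c>R$ we have $\ell_p(\mathcal F_p(\mathcal M\setminus B_{\mathcal M}))\simeq\mathcal F_p(\mathcal M\setminus B_{\mathcal M})$ and, provided that either $\mathcal M=\{0\}$ or at least one of the annuli $\mathcal M_{(R^k,cR^k]}$, $k\ge 0$, has at least two points, $$\mathcal F_p(\mathcal M\setminus B_{\mathcal M})\simeq\Big(\bigoplus_{n\in N}\mathcal F_p\big(\mathcal M_{(R^{\phi(n)},\,cR^{\phi(n)}]}\big)\Big)_p .$$ (ii) If $R<1$, then for every $0<c<R$ we have $\ell_p(\mathcal F_p(B_{\mathcal M}))\simeq\mathcal F_p(B_{\mathcal M})$ and, provided that either $\mathcal M=\{0\}$ or at least one of the annuli $\mathcal M_{(cR^k,R^k]}$, $k\ge 0$, has at least two points, $$\mathcal F_p(B_{\mathcal M})\simeq\Big(\bigoplus_{n\in N}\mathcal F_p\big(\mathcal M_{(cR^{\phi(n)},\,R^{\phi(n)}]}\big)\Big)_p .$$ In particular, if $\mathcal M$ is uniformly separated (distances between distinct points are bounded below by a positive constant) and $R>1$, or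 $\mathcal M$ is bounded and $R<1$, then $\mathcal F_p(\mathcal M)\simeq\ell_p(\mathcal F_p(\mathcal M))$. -/

import Mathlib

open Set

noncomputable section

/-!  Throughout, `p` is a real number with `0 < p ≤ 1`.

A `p`-norm `x ↦ ‖x‖ₚ` (absolutely homogeneous, with `‖x + y‖ₚ ^ p ≤ ‖x‖ₚ ^ p + ‖y‖ₚ ^ p`) is
encoded by its `p`-th power `N x = ‖x‖ₚ ^ p`, which is subadditive and satisfies
`N (a • x) = |a| ^ p * N x`. So `N` is a norm of additive groups in the sense of Mathlib, its
metric `N (x - y)` is the usual metric of the quasi-normed space, and a linear map is continuous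
if and only if it is bounded for the `p`-norms. -/

/-- The (semi)norm of `X` is the `p`-th power of a real `p`-(semi)norm. -/
class PHomogeneous (p : ℝ) (X : Type*) [SeminormedAddCommGroup X] [Module ℝ X] : Prop where
  norm_smul_eq : ∀ (a : ℝ) (x : X), ‖a • x‖ = |a| ^ p * ‖x‖

theorem PHomogeneous.uniformContinuousConstSMul (p : ℝ) (X : Type*) [SeminormedAddCommGroup X]
    [Module ℝ X] [PHomogeneous p X] : UniformContinuousConstSMul ℝ X where
  uniformContinuous_const_smul a := by
    have h : LipschitzWith (Real.toNNReal (|a| ^ p)) (fun x : X => a • x) := by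
      refine LipschitzWith.of_dist_le_mul fun x y => ?_
      rw [dist_eq_norm, dist_eq_norm, ← smul_sub, PHomogeneous.norm_smul_eq (p := p),
        Real.coe_toNNReal _ (by positivity)]
    exact h.uniformContinuous

theorem PHomogeneous.completion (p : ℝ) (X : Type*) [SeminormedAddCommGroup X] [Module ℝ X]
    [PHomogeneous p X] [UniformContinuousConstSMul ℝ X] :
    PHomogeneous p (UniformSpace.Completion X) where
  norm_smul_eq a x := by
    induction x using UniformSpace.Completion.induction_on with
    | hp =>
      exact isClosed_eq (continuous_const_smul a).norm (continuous_const.mul continuous_norm)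
    | ih m =>
      rw [← UniformSpace.Completion.coe_smul, UniformSpace.Completion.norm_coe,
        UniformSpace.Completion.norm_coe, PHomogeneous.norm_smul_eq (p := p)]

/-! ### `ℓ_p`-sums -/

/-- The `ℓ_p`-sum of a family of `p`-normed spaces: the families `(x i)` for which
`∑ i, ‖x i‖ₚ ^ p` is finite, with the `p`-norm whose `p`-th power is that sum. Since the norms of
the spaces `X i` are the `p`-th powers of the `p`-norms, this is the space of norm-summable
families, with the sum of the norms as its norm. -/
def LpSum (p : ℝ) {ι : Type*} (X : ι → Type*) [∀ i, NormedAddCommGroup (X i)]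
    [∀ i, Module ℝ (X i)] [∀ i, PHomogeneous p (X i)] : Type _ :=
  lp X 1

namespace LpSum

variable (p : ℝ) {ι : Type*} (X : ι → Type*) [∀ i, NormedAddCommGroup (X i)]
    [∀ i, Module ℝ (X i)] [∀ i, PHomogeneous p (X i)]

instance : NormedAddCommGroup (LpSum p X) :=
  inferInstanceAs (NormedAddCommGroup (lp X 1))

/-- The underlying linear subspace of the product; scalars act coordinatewise. -/
def submodule : Submodule ℝ (PreLp X) :=
  { lp X 1 with
    smul_mem' := fun a f hf => by
      have hf' : Memℓp f 1 := hf
      have h1 : 0 < (1 : ENNReal).toReal := by norm_num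
      refine memℓp_gen ?_
      have := (hf'.summable h1).mul_left (|a| ^ p)
      refine this.congr fun i => ?_
      have hs : ‖(a • f) i‖ = |a| ^ p * ‖f i‖ := PHomogeneous.norm_smul_eq a (f i)
      simp [hs] }

instance : Module ℝ (LpSum p X) :=
  inferInstanceAs (Module ℝ (submodule p X))

end LpSum

/-! ### Lipschitz free `p`-spaces -/

/-- The finitely supported real functions on `X` with sum zero, that is, the span of the
differences `δ x - δ y`. If a base point `o` of `X` is chosen, this is the linear span of the
evaluations on the real functions that vanish at `o`, the evaluation at `x` being `δ x - δ o`. -/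
def moleculeSubmodule (X : Type*) : Submodule ℝ (X →₀ ℝ) :=
  LinearMap.ker (Finsupp.linearCombination ℝ (fun _ : X => (1 : ℝ)))

/-- The space of molecules on `X`, which will carry the `p`-norm of the Lipschitz free
`p`-space. -/
def Molecules (_p : ℝ) (X : Type*) : Type _ :=
  moleculeSubmodule X

namespace Molecules

variable {p : ℝ} {X : Type*}

instance : AddCommGroup (Molecules p X) := inferInstanceAs (AddCommGroup (moleculeSubmodule X))

instance : Module ℝ (Molecules p X) := inferInstanceAs (Module ℝ (moleculeSubmodule X))

/-- The elementary molecule `δ x - δ y`. -/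
def diff (p : ℝ) (x y : X) : Molecules p X :=
  ⟨Finsupp.single x 1 - Finsupp.single y 1, by simp [moleculeSubmodule]⟩

/-- The `p`-th powers `ν` of the `p`-seminorms on the molecules for which
`δ x - δ y` has `p`-seminorm at most `dist x y`. These are exactly the maps
`∑ i, a i • δ (x i) ↦ ‖∑ i, a i • f (x i)‖ₚ ^ p` with `f` a `1`-Lipschitz map from `X` to a
`p`-normed space. -/
structure Admissible [MetricSpace X] (ν : Molecules p X → ℝ) : Prop where
  add_le : ∀ m n, ν (m + n) ≤ ν m + ν n
  smul_eq : ∀ (a : ℝ) (m : Molecules p X), ν (a • m) = |a| ^ p * ν m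
  diff_le : ∀ x y, ν (diff p x y) ≤ dist x y ^ p

/-- The `p`-th power of the `p`-norm of the Lipschitz free `p`-space: the supremum of
`‖∑ i, a i • f (x i)‖ₚ ^ p` over all `1`-Lipschitz maps `f` from `X` to a `p`-normed space. -/
def freeNorm [MetricSpace X] (m : Molecules p X) : ℝ :=
  sSup {r : ℝ | ∃ ν : Molecules p X → ℝ, Admissible ν ∧ r = ν m}

theorem ext_apply {m n : Molecules p X} (h : ∀ x, m.1 x = n.1 x) : m = n :=
  Subtype.ext (Finsupp.ext h)

/-- A molecule is a combination of differences `δ x - δ o`. -/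
theorem eq_sum_diff (m : Molecules p X) (o : X) :
    m = ∑ x ∈ m.1.support, m.1 x • diff p x o := by
  have key : ∀ g : X →₀ ℝ, g ∈ moleculeSubmodule X →
      g = ∑ x ∈ g.support, g x • (Finsupp.single x (1 : ℝ) - Finsupp.single o 1) := by
    intro g hg
    have h0 : ∑ x ∈ g.support, g x = 0 := by
      simpa [moleculeSubmodule, Finsupp.linearCombination_apply, Finsupp.sum] using hg
    have h1 : ∑ x ∈ g.support, Finsupp.single x (g x) = g := Finsupp.sum_single g
    have h2 : ∑ x ∈ g.support, g x • (Finsupp.single x (1 : ℝ) - Finsupp.single o 1)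
        = ∑ x ∈ g.support, Finsupp.single x (g x)
          - (∑ x ∈ g.support, g x) • Finsupp.single o (1 : ℝ) := by
      simp [smul_sub, Finset.sum_sub_distrib, Finset.sum_smul]
    rw [h2, h0, zero_smul, sub_zero, h1]
  refine Subtype.ext ((key m.1 m.2).trans ?_)
  exact (map_sum (moleculeSubmodule X).subtype
    (fun x => (m.1 x • diff p x o : moleculeSubmodule X)) m.1.support).symm

variable [MetricSpace X]

theorem Admissible.map_zero [hp : Fact (p ∈ Ioc (0 : ℝ) 1)] {ν : Molecules p X → ℝ}
    (h : Admissible ν) : ν 0 = 0 := by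
  have := h.smul_eq 0 0
  simpa [Real.zero_rpow hp.out.1.ne'] using this

theorem Admissible.neg_eq {ν : Molecules p X → ℝ} (h : Admissible ν) (m : Molecules p X) :
    ν (-m) = ν m := by
  have := h.smul_eq (-1) m
  simpa using this

theorem Admissible.nonneg [Fact (p ∈ Ioc (0 : ℝ) 1)] {ν : Molecules p X → ℝ}
    (h : Admissible ν) (m : Molecules p X) : 0 ≤ ν m := by
  have := h.add_le m (-m)
  rw [add_neg_cancel, h.map_zero, h.neg_eq] at this
  linarith

theorem admissible_zero : Admissible (fun _ : Molecules p X => (0 : ℝ)) where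
  add_le := by simp
  smul_eq := by simp
  diff_le := fun x y => by positivity

/-- The supremum that defines the free norm is finite. -/
theorem exists_bound [Fact (p ∈ Ioc (0 : ℝ) 1)] (m : Molecules p X) :
    ∃ C : ℝ, ∀ ν : Molecules p X → ℝ, Admissible ν → ν m ≤ C := by
  classical
  rcases isEmpty_or_nonempty X with hX | ⟨⟨o⟩⟩
  · refine ⟨0, fun ν hν => ?_⟩
    have : m = 0 := ext_apply fun x => (hX.false x).elim
    rw [this, hν.map_zero]
  · refine ⟨∑ x ∈ m.1.support, |m.1 x| ^ p * dist x o ^ p, fun ν hν => ?_⟩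
    have hsum : ∀ (s : Finset X) (g : X → Molecules p X), ν (∑ x ∈ s, g x) ≤ ∑ x ∈ s, ν (g x) := by
      intro s g
      induction s using Finset.induction_on with
      | empty => simp [hν.map_zero]
      | insert x s hx ih =>
        rw [Finset.sum_insert hx, Finset.sum_insert hx]
        exact (hν.add_le _ _).trans (by linarith)
    have hm : m = ∑ x ∈ m.1.support, m.1 x • diff p x o := eq_sum_diff m o
    calc ν m = ν (∑ x ∈ m.1.support, m.1 x • diff p x o) := by rw [← hm]
      _ ≤ ∑ x ∈ m.1.support, ν (m.1 x • diff p x o) := hsum _ _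
      _ ≤ _ := Finset.sum_le_sum fun x _ => by
          rw [hν.smul_eq]
          exact mul_le_mul_of_nonneg_left (hν.diff_le x o) (by positivity)

theorem le_freeNorm [Fact (p ∈ Ioc (0 : ℝ) 1)] {ν : Molecules p X → ℝ} (h : Admissible ν)
    (m : Molecules p X) : ν m ≤ freeNorm m := by
  obtain ⟨C, hC⟩ := exists_bound m
  refine le_csSup ⟨C, ?_⟩ ⟨ν, h, rfl⟩
  rintro r ⟨μ, hμ, rfl⟩
  exact hC μ hμ

theorem freeNorm_le {m : Molecules p X} {C : ℝ}
    (h : ∀ ν : Molecules p X → ℝ, Admissible ν → ν m ≤ C) : freeNorm m ≤ C := by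
  refine csSup_le ⟨0, fun _ => 0, admissible_zero, rfl⟩ ?_
  rintro r ⟨ν, hν, rfl⟩
  exact h ν hν

/-- The free norm is itself admissible: it is the largest admissible functional. -/
theorem admissible_freeNorm [hp : Fact (p ∈ Ioc (0 : ℝ) 1)] :
    Admissible (freeNorm : Molecules p X → ℝ) where
  add_le m n := freeNorm_le fun ν hν =>
    (hν.add_le m n).trans (add_le_add (le_freeNorm hν m) (le_freeNorm hν n))
  smul_eq a m := by
    have hle : ∀ (b : ℝ) (n : Molecules p X), freeNorm (b • n) ≤ |b| ^ p * freeNorm n :=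
      fun b n => freeNorm_le fun ν hν => by
        rw [hν.smul_eq]
        exact mul_le_mul_of_nonneg_left (le_freeNorm hν n) (by positivity)
    refine le_antisymm (hle a m) ?_
    by_cases ha : a = 0
    · subst ha
      have := le_freeNorm admissible_zero ((0 : ℝ) • m)
      simpa [Real.zero_rpow hp.out.1.ne'] using this
    · have h1 := hle a⁻¹ (a • m)
      rw [inv_smul_smul₀ ha, abs_inv, Real.inv_rpow (abs_nonneg a)] at h1
      have h2 : 0 < |a| ^ p := Real.rpow_pos_of_pos (abs_pos.mpr ha) p
      rwa [inv_mul_eq_div, le_div_iff₀ h2, mul_comm] at h1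
  diff_le x y := freeNorm_le fun ν hν => hν.diff_le x y

instance [Fact (p ∈ Ioc (0 : ℝ) 1)] : SeminormedAddCommGroup (Molecules p X) :=
  AddGroupSeminorm.toSeminormedAddCommGroup
    { toFun := freeNorm
      map_zero' := admissible_freeNorm.map_zero
      add_le' := admissible_freeNorm.add_le
      neg' := admissible_freeNorm.neg_eq }

instance [Fact (p ∈ Ioc (0 : ℝ) 1)] : PHomogeneous p (Molecules p X) where
  norm_smul_eq := admissible_freeNorm.smul_eq

instance [Fact (p ∈ Ioc (0 : ℝ) 1)] : UniformContinuousConstSMul ℝ (Molecules p X) :=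
  PHomogeneous.uniformContinuousConstSMul p _

end Molecules

/-- The Lipschitz free `p`-space `F_p(X)` over a metric space `X`: the completion of the space of
molecules. It needs no base point (for any choice of one it is the usual space), and it is the
zero space if `X` is empty or a single point. -/
def LipschitzFree (p : ℝ) [Fact (p ∈ Ioc (0 : ℝ) 1)] (X : Type*) [MetricSpace X] : Type _ :=
  UniformSpace.Completion (Molecules p X)

namespace LipschitzFree

variable (p : ℝ) [Fact (p ∈ Ioc (0 : ℝ) 1)] (X : Type*) [MetricSpace X]

instance : NormedAddCommGroup (LipschitzFree p X) :=
  inferInstanceAs (NormedAddCommGroup (UniformSpace.Completion (Molecules p X)))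

instance : Module ℝ (LipschitzFree p X) :=
  inferInstanceAs (Module ℝ (UniformSpace.Completion (Molecules p X)))

instance : CompleteSpace (LipschitzFree p X) :=
  inferInstanceAs (CompleteSpace (UniformSpace.Completion (Molecules p X)))

instance : PHomogeneous p (LipschitzFree p X) :=
  PHomogeneous.completion p (Molecules p X)

end LipschitzFree

/-- Two quasi-Banach spaces are isomorphic if there are mutually inverse continuous linear maps
between them. -/
def Isomorphic (X Y : Type*) [TopologicalSpace X] [AddCommGroup X] [Module ℝ X]
    [TopologicalSpace Y] [AddCommGroup Y] [Module ℝ Y] : Prop :=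
  Nonempty (X ≃L[ℝ] Y)

/-! ### Metric notions -/

/-- A metric space is doubling if, for some `D`, every ball of radius `r > 0` can be covered by at
most `D` balls of radius `r / 2`. -/
def IsDoubling (M : Type*) [MetricSpace M] : Prop :=
  ∃ D : ℕ, ∀ (x : M) (r : ℝ), 0 < r →
    ∃ t : Finset M, t.card ≤ D ∧ Metric.closedBall x r ⊆ ⋃ y ∈ t, Metric.closedBall y (r / 2)

/-- The pointed metric space `(M, o)` is `R`-closed if some self-map of `M` fixes `o` and
multiplies all distances by `R`. -/
def IsRClosed {M : Type*} [MetricSpace M] (o : M) (R : ℝ) : Prop :=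
  ∃ f : M → M, f o = o ∧ ∀ x y, dist (f x) (f y) = R * dist x y

/-- A metric space is uniformly separated if the distances between distinct points are bounded
away from zero. -/
def IsUniformlySeparated (M : Type*) [MetricSpace M] : Prop :=
  ∃ s : ℝ, 0 < s ∧ ∀ x y : M, x ≠ y → s ≤ dist x y

/-- The annulus `{x | a < dist o x ≤ b}` around the base point `o`. -/
def annulus {M : Type*} [MetricSpace M] (o : M) (a b : ℝ) : Set M :=
  {x | dist o x ∈ Ioc a b}

end

/-! Let `A k` be the annulus at scale `R ^ k`, let `S` be one of the sets of the theorem, and let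
`W` be the `ℓ_p`-sum of the spaces `F_p(A k)` over all `k`. Everything follows from `F_p(S) ≃
ℓ_p(W)`, which Pełczyński's decomposition method (`isomorphic_lpSum_of_isComplementedIn`) reduces to
two complementation statements: `F_p(S)` in `W`, and `ℓ_p(W)` in `F_p(S)`.

The analytic input is `IsDoubling.exists_extension`: a Lipschitz map from a subset of a doubling
space into any complete `p`-normed space extends, with a constant depending only on the space and
`p`. The extension averages nearby values over a Whitney partition of unity. Local convexity is not
needed, since at each point only boundedly many terms occur. Lipschitz extensions linearize to
projections between free spaces.

Dilation embeds `A k` in every later annulus, so `F_p(A k)` is uniformly complemented in `F_p(A m)`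
for `k ≤ m` (`exists_isBoundedlyComplementedIn`). Sending the copies `(i, k)` injectively to levels
at least `k` makes `ℓ_p(W)` complemented in `W`, and choosing levels with large gaps makes it
complemented in `F_p(S)` (`isComplementedIn_free`): far apart annuli behave like an `ℓ_p`-sum.

Conversely, a radial partition of unity `w k` splits `δ x - δ o` as `∑ w k x • (δ x - δ o)`. Each
term is a vector of `F_p(A k)` plus a multiple of the difference between a base point of `A k` and
`o`. Hence `F_p(S)` is complemented in `W ⊕ ℓ_p(F_p(Z))` for any `Z` with two points
(`free_isComplementedIn`). Taking for `Z` an annulus with two points, the second summand is absorbed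
by `W`. -/

open Set

noncomputable section

/-! ### Bounded linear maps between `p`-normed spaces -/

section Bounded

variable {p : ℝ} {X Y : Type*} [SeminormedAddCommGroup X] [Module ℝ X]
  [SeminormedAddCommGroup Y] [Module ℝ Y]

/-- A linear map with a norm bound, as a continuous linear map. -/
def LinearMap.toContinuousOfBound (f : X →ₗ[ℝ] Y) (C : ℝ) (h : ∀ x, ‖f x‖ ≤ C * ‖x‖) :
    X →L[ℝ] Y where
  toLinearMap := f
  cont := AddMonoidHomClass.continuous_of_bound f C h

@[simp]
theorem LinearMap.toContinuousOfBound_apply (f : X →ₗ[ℝ] Y) (C : ℝ)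
    (h : ∀ x, ‖f x‖ ≤ C * ‖x‖) (x : X) : f.toContinuousOfBound C h x = f x := rfl

/-- A continuous linear map between `p`-normed spaces is bounded. -/
theorem ContinuousLinearMap.exists_bound_of_pHomogeneous [hp : Fact (p ∈ Ioc (0 : ℝ) 1)]
    [PHomogeneous p X] [PHomogeneous p Y] (T : X →L[ℝ] Y) :
    ∃ C : ℝ, 0 ≤ C ∧ ∀ x, ‖T x‖ ≤ C * ‖x‖ := by
  have hp0 : 0 < p := hp.out.1
  obtain ⟨δ, hδ, h⟩ := Metric.continuous_iff.1 T.continuous 0 1 one_pos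
  have h' : ∀ x : X, ‖x‖ < δ → ‖T x‖ ≤ 1 := fun x hx => by
    have := h x (by simpa using hx)
    simpa using this.le
  refine ⟨2 / δ, by positivity, fun x => ?_⟩
  -- The norms are `p`-th powers, so scaling a vector by `t ^ p⁻¹` multiplies its norm by `t`.
  have key : ∀ t : ℝ, 0 < t → t * ‖x‖ < δ → t * ‖T x‖ ≤ 1 := by
    intro t ht htx
    have ha : |t ^ p⁻¹| ^ p = t := by
      rw [abs_of_nonneg (by positivity), ← Real.rpow_mul ht.le, inv_mul_cancel₀ hp0.ne',
        Real.rpow_one]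
    have := h' (t ^ p⁻¹ • x) (by rwa [PHomogeneous.norm_smul_eq (p := p), ha])
    rwa [map_smul, PHomogeneous.norm_smul_eq (p := p), ha] at this
  rcases (norm_nonneg x).eq_or_lt with h0 | hpos
  · rw [← h0, mul_zero]
    by_contra! hlt
    have := key (2 / ‖T x‖) (by positivity) (by rw [← h0]; simpa using hδ)
    rw [div_mul_cancel₀ _ hlt.ne'] at this
    linarith
  · have := key (δ / (2 * ‖x‖)) (by positivity) (by
      rw [div_mul_eq_mul_div, div_lt_iff₀ (by positivity)]
      nlinarith [mul_pos hδ hpos])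
    rw [div_mul_eq_mul_div, div_le_one (by positivity)] at this
    rw [div_mul_eq_mul_div, le_div_iff₀ hδ]
    linarith

theorem norm_sum_smul_le [PHomogeneous p X] {ι : Type*} (s : Finset ι) (a : ι → ℝ) (v : ι → X) :
    ‖∑ i ∈ s, a i • v i‖ ≤ ∑ i ∈ s, |a i| ^ p * ‖v i‖ :=
  (norm_sum_le _ _).trans_eq <| Finset.sum_congr rfl fun _ _ => PHomogeneous.norm_smul_eq _ _

end Bounded

/-! ### Maps into and out of `ℓ_p`-sums -/

namespace LpSum

section

variable {p : ℝ} {ι : Type*} {X : ι → Type*} [∀ i, NormedAddCommGroup (X i)]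
    [∀ i, Module ℝ (X i)] [∀ i, PHomogeneous p (X i)]

/-- The `i`-th coordinate. -/
def proj (i : ι) : LpSum p X →ₗ[ℝ] X i where
  toFun x := x.1 i
  map_add' _ _ := rfl
  map_smul' _ _ := rfl

@[ext]
theorem ext {x y : LpSum p X} (h : ∀ i, proj i x = proj i y) : x = y :=
  Subtype.ext (funext h)

theorem hasSum_norm (x : LpSum p X) : HasSum (fun i => ‖proj i x‖) ‖x‖ := by
  have := lp.hasSum_norm (p := 1) (by norm_num) (x : lp X 1)
  simp only [ENNReal.toReal_one, Real.rpow_one] at this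
  exact this

theorem norm_proj_le (i : ι) (x : LpSum p X) : ‖proj i x‖ ≤ ‖x‖ :=
  le_hasSum (hasSum_norm x) i fun _ _ => norm_nonneg _

/-- A norm-summable family, as an element of the `ℓ_p`-sum. -/
def mk (f : ∀ i, X i) (hf : Summable fun i => ‖f i‖) : LpSum p X :=
  (⟨f, memℓp_gen (by simpa using hf)⟩ : lp X 1)

@[simp]
theorem proj_mk (f : ∀ i, X i) (hf : Summable fun i => ‖f i‖) (i : ι) :
    proj i (mk (p := p) f hf) = f i := rfl

theorem norm_mk (f : ∀ i, X i) (hf : Summable fun i => ‖f i‖) :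
    ‖mk (p := p) f hf‖ = ∑' i, ‖f i‖ := (hasSum_norm (mk f hf)).tsum_eq.symm

instance : PHomogeneous p (LpSum p X) where
  norm_smul_eq a x := by
    refine (hasSum_norm (a • x)).unique ?_
    simpa [PHomogeneous.norm_smul_eq (p := p)] using (hasSum_norm x).mul_left (|a| ^ p)

instance [∀ i, CompleteSpace (X i)] : CompleteSpace (LpSum p X) :=
  inferInstanceAs (CompleteSpace (lp X 1))

theorem continuous_proj (i : ι) : Continuous (proj (p := p) (X := X) i) :=
  AddMonoidHomClass.continuous_of_bound (proj i) 1 fun x => by simpa using norm_proj_le i x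

section single

variable [DecidableEq ι]

/-- The inclusion of the `i`-th summand. -/
def single (i : ι) : X i →ₗ[ℝ] LpSum p X where
  toFun x := lp.single 1 i x
  map_add' := lp.single_add 1 i
  map_smul' a x := by
    refine Subtype.ext ?_
    change _ = a • Pi.single i x
    rw [← Pi.single_smul]
    rfl

@[simp]
theorem proj_single_self (i : ι) (x : X i) : proj i (single (p := p) i x) = x :=
  lp.single_apply_self 1 i x

theorem proj_single_ne {i j : ι} (h : j ≠ i) (x : X i) : proj j (single (p := p) i x) = 0 :=
  lp.single_apply_ne 1 i x h

theorem norm_single (i : ι) (x : X i) : ‖single (p := p) i x‖ = ‖x‖ :=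
  lp.norm_single (p := 1) (by norm_num) i x

/-- The inclusion of a summand, as a continuous linear map. -/
def singleL (i : ι) : X i →L[ℝ] LpSum p X :=
  (single i).toContinuousOfBound 1 fun x => by rw [norm_single, one_mul]

@[simp]
theorem singleL_apply (i : ι) (x : X i) : singleL (p := p) i x = single i x := rfl

theorem hasSum_single (x : LpSum p X) : HasSum (fun i => single i (proj i x)) x :=
  lp.hasSum_single (p := 1) (by norm_num) (x : lp X 1)

theorem clm_ext {Z : Type*} [TopologicalSpace Z] [T2Space Z] [AddCommGroup Z] [Module ℝ Z]
    {S T : LpSum p X →L[ℝ] Z} (h : ∀ i x, S (single i x) = T (single i x)) : S = T := by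
  ext x
  have hS := (hasSum_single x).mapL S
  have hT := (hasSum_single x).mapL T
  simp only [h] at hS
  exact hS.unique hT

theorem comp_eq_of_single {V Z : Type*} [TopologicalSpace V] [AddCommGroup V] [Module ℝ V]
    [TopologicalSpace Z] [T2Space Z] [AddCommGroup Z] [Module ℝ Z] {A : LpSum p X →L[ℝ] V}
    {B : V →L[ℝ] Z} (T : LpSum p X →L[ℝ] Z)
    (h : ∀ i x, B (A (single i x)) = T (single i x)) (x : LpSum p X) : B (A x) = T x :=
  DFunLike.congr_fun (clm_ext (S := B.comp A) h) x

end single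

section lift

variable {Z : Type*} [NormedAddCommGroup Z] [Module ℝ Z]

theorem summable_norm_of_bound (T : ∀ i, X i →ₗ[ℝ] Z) {C : ℝ} (hT : ∀ i x, ‖T i x‖ ≤ C * ‖x‖)
    (x : LpSum p X) : Summable fun i => ‖T i (proj i x)‖ :=
  .of_nonneg_of_le (fun _ => norm_nonneg _) (fun i => hT i _) ((hasSum_norm x).summable.mul_left C)

variable [PHomogeneous p Z] [CompleteSpace Z]

/-- The linear map on an `ℓ_p`-sum given by uniformly bounded linear maps on the summands. -/
def lift (T : ∀ i, X i →ₗ[ℝ] Z) {C : ℝ} (hT : ∀ i x, ‖T i x‖ ≤ C * ‖x‖) : LpSum p X →L[ℝ] Z :=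
  LinearMap.toContinuousOfBound
    { toFun := fun x => ∑' i, T i (proj i x)
      map_add' := fun x y => by
        simp only [map_add]
        exact (summable_norm_of_bound T hT x).of_norm.tsum_add
          (summable_norm_of_bound T hT y).of_norm
      map_smul' := fun a x => by
        have := PHomogeneous.uniformContinuousConstSMul p Z
        simp only [map_smul, RingHom.id_apply]
        exact (summable_norm_of_bound T hT x).of_norm.tsum_const_smul a }
    C fun x => (norm_tsum_le_tsum_norm (summable_norm_of_bound T hT x)).trans <| by
      rw [← (hasSum_norm x).tsum_eq, ← tsum_mul_left]
      exact (summable_norm_of_bound T hT x).tsum_le_tsum (fun i => hT i _)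
        ((hasSum_norm x).summable.mul_left C)

theorem lift_apply (T : ∀ i, X i →ₗ[ℝ] Z) {C : ℝ} (hT : ∀ i x, ‖T i x‖ ≤ C * ‖x‖)
    (x : LpSum p X) : lift T hT x = ∑' i, T i (proj i x) := rfl

@[simp]
theorem lift_single [DecidableEq ι] (T : ∀ i, X i →ₗ[ℝ] Z) {C : ℝ}
    (hT : ∀ i x, ‖T i x‖ ≤ C * ‖x‖) (i : ι) (x : X i) : lift T hT (single (p := p) i x) = T i x := by
  rw [lift_apply, tsum_eq_single i, proj_single_self]
  intro j hj
  rw [proj_single_ne hj, map_zero]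

end lift

/-- The linear map into an `ℓ_p`-sum with given coordinates. -/
def pi {W : Type*} [SeminormedAddCommGroup W] [Module ℝ W] (S : ∀ i, W →ₗ[ℝ] X i)
    (hS : ∀ w, Summable fun i => ‖S i w‖) (C : ℝ) (hC : ∀ w, ∑' i, ‖S i w‖ ≤ C * ‖w‖) :
    W →L[ℝ] LpSum p X :=
  LinearMap.toContinuousOfBound
    { toFun := fun w => mk (fun i => S i w) (hS w)
      map_add' := fun w w' => by ext i; simp
      map_smul' := fun a w => by ext i; simp }
    C fun w => (norm_mk _ (hS w)).trans_le (hC w)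

@[simp]
theorem proj_pi {W : Type*} [SeminormedAddCommGroup W] [Module ℝ W] (S : ∀ i, W →ₗ[ℝ] X i)
    (hS : ∀ w, Summable fun i => ‖S i w‖) (C : ℝ) (hC : ∀ w, ∑' i, ‖S i w‖ ≤ C * ‖w‖) (i : ι)
    (w : W) : proj i (pi (p := p) S hS C hC w) = S i w := rfl

end

end LpSum

/-! ### Complemented subspaces -/

/-- `X` is isomorphic to a complemented subspace of `Y`. -/
def IsComplementedIn (X Y : Type*) [TopologicalSpace X] [AddCommGroup X] [Module ℝ X]
    [TopologicalSpace Y] [AddCommGroup Y] [Module ℝ Y] : Prop :=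
  ∃ (j : X →L[ℝ] Y) (q : Y →L[ℝ] X), ∀ x, q (j x) = x

/-- `X` is isomorphic to a complemented subspace of `Y`, with bounds `A` and `B` on the embedding
and on the projection. -/
def IsBoundedlyComplementedIn (A B : ℝ) (X Y : Type*) [NormedAddCommGroup X] [Module ℝ X]
    [NormedAddCommGroup Y] [Module ℝ Y] : Prop :=
  ∃ (j : X →ₗ[ℝ] Y) (q : Y →ₗ[ℝ] X), (∀ x, ‖j x‖ ≤ A * ‖x‖) ∧ (∀ y, ‖q y‖ ≤ B * ‖y‖) ∧
    ∀ x, q (j x) = x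

section

variable {X Y Z : Type*} [TopologicalSpace X] [AddCommGroup X] [Module ℝ X]
    [TopologicalSpace Y] [AddCommGroup Y] [Module ℝ Y]
    [TopologicalSpace Z] [AddCommGroup Z] [Module ℝ Z]

theorem IsComplementedIn.refl (X : Type*) [TopologicalSpace X] [AddCommGroup X] [Module ℝ X] :
    IsComplementedIn X X :=
  ⟨.id ℝ X, .id ℝ X, fun _ => rfl⟩

theorem IsComplementedIn.trans (h : IsComplementedIn X Y) (h' : IsComplementedIn Y Z) :
    IsComplementedIn X Z := by
  obtain ⟨j, q, h⟩ := h
  obtain ⟨j', q', h'⟩ := h'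
  exact ⟨j'.comp j, q.comp q', fun x => by simp [h, h']⟩

theorem Isomorphic.isComplementedIn (h : Isomorphic X Y) : IsComplementedIn X Y :=
  let ⟨e⟩ := h
  ⟨e, e.symm, fun x => e.symm_apply_apply x⟩

theorem Isomorphic.symm (h : Isomorphic X Y) : Isomorphic Y X :=
  let ⟨e⟩ := h
  ⟨e.symm⟩

theorem Isomorphic.trans (h : Isomorphic X Y) (h' : Isomorphic Y Z) : Isomorphic X Z :=
  let ⟨e⟩ := h
  let ⟨e'⟩ := h'
  ⟨e.trans e'⟩

theorem Isomorphic.of_subsingleton (X Y : Type*) [TopologicalSpace X] [AddCommGroup X]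
    [Module ℝ X] [TopologicalSpace Y] [AddCommGroup Y] [Module ℝ Y] [Subsingleton X]
    [Subsingleton Y] : Isomorphic X Y :=
  ⟨⟨⟨0, 0, fun _ => Subsingleton.elim _ _, fun _ => Subsingleton.elim _ _⟩,
    continuous_zero, continuous_zero⟩⟩

end

namespace LpSum

variable {p : ℝ} {ι κ : Type*}

/-- Reindexing along an injection embeds an `ℓ_p`-sum as a complemented subspace, if the summands
embed as uniformly complemented subspaces. -/
theorem isComplementedIn_of_injective {X : ι → Type*} [∀ i, NormedAddCommGroup (X i)]
    [∀ i, Module ℝ (X i)] [∀ i, PHomogeneous p (X i)] {Y : κ → Type*}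
    [∀ i, NormedAddCommGroup (Y i)] [∀ i, Module ℝ (Y i)] [∀ i, PHomogeneous p (Y i)]
    [∀ i, CompleteSpace (Y i)] {e : ι → κ} (he : Function.Injective e) {A B : ℝ} (hB : 0 ≤ B)
    (h : ∀ i, IsBoundedlyComplementedIn A B (X i) (Y (e i))) :
    IsComplementedIn (LpSum p X) (LpSum p Y) := by
  classical
  choose j q hj hq hqj using h
  have hs : ∀ y : LpSum p Y, Summable fun i => ‖q i (proj (e i) y)‖ := fun y =>
    .of_nonneg_of_le (fun _ => norm_nonneg _) (fun i => hq i _)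
      (((hasSum_norm y).summable.comp_injective he).mul_left B)
  refine ⟨lift (fun i => (single (e i)).comp (j i)) (C := A) fun i x => by
      simpa [norm_single] using hj i x,
    pi (fun i => (q i).comp (proj (e i))) hs B fun y => ?_, fun x => ?_⟩
  · calc ∑' i, ‖q i (proj (e i) y)‖ ≤ ∑' i, B * ‖proj (e i) y‖ :=
        (hs y).tsum_le_tsum (fun i => hq i _)
          (((hasSum_norm y).summable.comp_injective he).mul_left B)
      _ ≤ B * ‖y‖ := by
        rw [tsum_mul_left, ← (hasSum_norm y).tsum_eq]
        gcongr
        exact tsum_comp_le_tsum_of_inj (hasSum_norm y).summable (fun _ => norm_nonneg _) he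
  · refine comp_eq_of_single (.id ℝ _) (fun i x => ?_) x
    refine LpSum.ext fun i' => ?_
    simp only [lift_single, proj_pi, LinearMap.comp_apply,
      ContinuousLinearMap.id_apply]
    by_cases hi : i' = i
    · subst hi
      simp [hqj]
    · rw [proj_single_ne hi, proj_single_ne (he.ne hi), map_zero]

/-- An iterated `ℓ_p`-sum embeds as a complemented subspace of the `ℓ_p`-sum over pairs. -/
theorem isComplementedIn_prod {X : κ → Type*} [∀ i, NormedAddCommGroup (X i)]
    [∀ i, Module ℝ (X i)] [∀ i, PHomogeneous p (X i)] [∀ i, CompleteSpace (X i)] :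
    IsComplementedIn (LpSum p fun _ : ι => LpSum p X) (LpSum p fun x : ι × κ => X x.2) := by
  classical
  have hs : ∀ (y : LpSum p fun x : ι × κ => X x.2) (i : ι),
      Summable fun k => ‖proj (i, k) y‖ := fun y i =>
    (hasSum_norm y).summable.comp_injective (Prod.mk_right_injective i)
  have hsum : ∀ y : LpSum p fun x : ι × κ => X x.2,
      HasSum (fun i => ∑' k, ‖proj (i, k) y‖) ‖y‖ := fun y =>
    (hasSum_norm y).prod_fiberwise fun i => (hs y i).hasSum
  let r : ι → (LpSum p fun x : ι × κ => X x.2) →L[ℝ] LpSum p X := fun i =>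
    pi (fun k => proj (i, k)) (fun y => hs y i) 1 fun y => by
      rw [one_mul]
      exact le_hasSum (hsum y) i fun _ _ => tsum_nonneg fun _ => norm_nonneg _
  have hr : ∀ i y, ‖r i y‖ = ∑' k, ‖proj (i, k) y‖ := fun i y => norm_mk _ (hs y i)
  let l : ι → LpSum p X →L[ℝ] LpSum p fun x : ι × κ => X x.2 := fun i =>
    lift (fun k => single (X := fun x : ι × κ => X x.2) (i, k)) (C := 1) fun k x => by
      rw [norm_single (X := fun x : ι × κ => X x.2), one_mul]
  have hl : ∀ i x, ‖l i x‖ ≤ 1 * ‖x‖ := fun i x => by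
    rw [one_mul]
    refine (norm_tsum_le_tsum_norm ?_).trans_eq ?_
    · simpa [norm_single (X := fun x : ι × κ => X x.2)] using (hasSum_norm x).summable
    · simpa [norm_single (X := fun x : ι × κ => X x.2)] using (hasSum_norm x).tsum_eq
  refine ⟨lift (fun i => (l i).toLinearMap) (C := 1) hl,
    pi (fun i => (r i).toLinearMap) (fun y => ?_) 1 fun y => ?_, fun x => ?_⟩
  · simpa [hr] using (hsum y).summable
  · simpa [hr] using (hsum y).tsum_eq.le
  · refine comp_eq_of_single (.id ℝ _) (fun i x => ?_) x
    refine LpSum.ext fun i' => ?_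
    simp only [lift_single, proj_pi, ContinuousLinearMap.coe_coe,
      ContinuousLinearMap.id_apply]
    revert x
    by_cases hi : i' = i
    · subst hi
      intro x
      rw [proj_single_self]
      refine comp_eq_of_single (.id ℝ _) (fun k z => ?_) x
      ext k'
      simp only [l, r, lift_single, proj_pi,
        ContinuousLinearMap.id_apply]
      by_cases hk : k' = k
      · subst hk
        rw [proj_single_self (X := fun x : ι × κ => X x.2), proj_single_self]
      · rw [proj_single_ne hk, proj_single_ne (X := fun x : ι × κ => X x.2) (by simp [hk])]
    · intro x
      rw [proj_single_ne hi]
      refine comp_eq_of_single 0 (fun k z => ?_) x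
      ext k'
      simp only [l, r, lift_single, proj_pi]
      rw [proj_single_ne (X := fun x : ι × κ => X x.2) (by simp [hi])]
      rfl

end LpSum

/-! ### The decomposition method -/

namespace LpSum

variable {p : ℝ} {U : Type*} [NormedAddCommGroup U] [Module ℝ U] [PHomogeneous p U]

/-- The left shift. -/
def shiftLeft : (LpSum p fun _ : ℕ => U) →L[ℝ] LpSum p fun _ : ℕ => U :=
  pi (fun n => proj (n + 1)) (fun w => (summable_nat_add_iff 1).2 (hasSum_norm w).summable) 1
    fun w => by
      rw [one_mul, ← (hasSum_norm w).tsum_eq]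
      exact tsum_comp_le_tsum_of_inj (hasSum_norm w).summable (fun _ => norm_nonneg _)
        (add_left_injective 1)

@[simp]
theorem proj_shiftLeft (n : ℕ) (x : LpSum p fun _ : ℕ => U) :
    proj n (shiftLeft x) = proj (n + 1) x := rfl

/-- The coordinates of the right shift. -/
def predProj : ℕ → (LpSum p fun _ : ℕ => U) →ₗ[ℝ] U
  | 0 => 0
  | n + 1 => proj n

theorem hasSum_norm_predProj (w : LpSum p fun _ : ℕ => U) :
    HasSum (fun n => ‖predProj n w‖) ‖w‖ := by
  rw [← hasSum_nat_add_iff' 1]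
  simpa [predProj] using hasSum_norm w

/-- The right shift. -/
def shiftRight : (LpSum p fun _ : ℕ => U) →L[ℝ] LpSum p fun _ : ℕ => U :=
  pi predProj (fun w => (hasSum_norm_predProj w).summable) 1
    fun w => by rw [one_mul, (hasSum_norm_predProj w).tsum_eq]

@[simp]
theorem proj_shiftRight_zero (x : LpSum p fun _ : ℕ => U) : proj 0 (shiftRight x) = 0 := rfl

@[simp]
theorem proj_shiftRight_succ (n : ℕ) (x : LpSum p fun _ : ℕ => U) :
    proj (n + 1) (shiftRight x) = proj n x := rfl

/-- The coordinates of an `ℓ_p`-space as continuous linear maps. -/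
def projL {ι : Type*} (i : ι) : (LpSum p fun _ : ι => U) →L[ℝ] U :=
  ⟨proj i, continuous_proj i⟩

@[simp]
theorem projL_apply {ι : Type*} (i : ι) (x : LpSum p fun _ : ι => U) :
    projL i x = proj i x := rfl

variable [Fact (p ∈ Ioc (0 : ℝ) 1)]

/-- The map between `ℓ_p`-spaces that applies a continuous linear map to every coordinate. -/
def map {V : Type*} [NormedAddCommGroup V] [Module ℝ V] [PHomogeneous p V] {ι : Type*}
    (T : U →L[ℝ] V) : (LpSum p fun _ : ι => U) →L[ℝ] LpSum p fun _ : ι => V :=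
  pi (fun i => T.toLinearMap.comp (proj i))
    (fun w => by
      obtain ⟨C, -, hC⟩ := T.exists_bound_of_pHomogeneous (p := p)
      exact .of_nonneg_of_le (fun _ => norm_nonneg _) (fun i => hC _)
        ((hasSum_norm w).summable.mul_left C))
    (T.exists_bound_of_pHomogeneous (p := p)).choose fun w => by
      have hC := (T.exists_bound_of_pHomogeneous (p := p)).choose_spec.2
      rw [← (hasSum_norm w).tsum_eq, ← tsum_mul_left]
      have hs := (hasSum_norm w).summable.mul_left
        (T.exists_bound_of_pHomogeneous (p := p)).choose
      exact (Summable.of_nonneg_of_le (fun _ => norm_nonneg _) (fun i => hC _) hs).tsum_le_tsum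
        (fun i => hC _) hs

@[simp]
theorem proj_map {V : Type*} [NormedAddCommGroup V] [Module ℝ V] [PHomogeneous p V] {ι : Type*}
    (T : U →L[ℝ] V) (i : ι) (x : LpSum p fun _ : ι => U) :
    proj i (map T x) = T (proj i x) := rfl

end LpSum

open LpSum

theorem isComplementedIn_lpSum {p : ℝ} {U : Type*} [NormedAddCommGroup U] [Module ℝ U]
    [PHomogeneous p U] {ι : Type*} [Nonempty ι] :
    IsComplementedIn U (LpSum p fun _ : ι => U) := by
  classical
  obtain ⟨i⟩ := ‹Nonempty ι›
  exact ⟨singleL (X := fun _ : ι => U) i, projL i, fun x => proj_single_self (X := fun _ : ι => U) i x⟩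

section

variable {p : ℝ} [Fact (p ∈ Ioc (0 : ℝ) 1)]
  {U : Type*} [NormedAddCommGroup U] [Module ℝ U] [PHomogeneous p U]
  {V : Type*} [TopologicalSpace V] [AddCommGroup V] [Module ℝ V]

/-- If `V` is complemented in `U`, then `V ⊕ ℓ_p(U) ≃ ℓ_p(U)`. -/
theorem IsComplementedIn.isomorphic_prod [IsTopologicalAddGroup V] (h : IsComplementedIn V U) :
    Isomorphic (LpSum p fun _ : ℕ => U) (V × LpSum p fun _ : ℕ => U) := by
  obtain ⟨j, q, hqj⟩ := h
  let P : U →L[ℝ] U := j.comp q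
  have hqP : ∀ u, q (P u) = q u := fun u => hqj _
  have hPj : ∀ v, P (j v) = j v := fun v => by simp [P, hqj]
  have hPP : ∀ u, P (P u) = P u := fun u => hPj _
  let PP : (LpSum p fun _ : ℕ => U) →L[ℝ] LpSum p fun _ : ℕ => U := map P
  -- Each coordinate splits into its part in the range of `P` and its part in the kernel. The map
  -- `f` keeps the kernel parts in place and shifts the range parts one step to the left, the first
  -- of them landing in `V`; `g` undoes this. The complement of `V` never has to be named.
  let f : (LpSum p fun _ : ℕ => U) →L[ℝ] V × LpSum p fun _ : ℕ => U :=
    (q.comp (projL 0)).prod (.id ℝ _ - PP + PP.comp shiftLeft)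
  let g : (V × LpSum p fun _ : ℕ => U) →L[ℝ] LpSum p fun _ : ℕ => U :=
    (((singleL (X := fun _ : ℕ => U) 0).comp j).comp (.fst ℝ _ _)) +
      (.id ℝ _ - PP + shiftRight.comp PP).comp (.snd ℝ _ _)
  have hf1 : ∀ u, (f u).1 = q (proj 0 u) := fun u => rfl
  have hf2 : ∀ u n, proj n (f u).2 = proj n u - P (proj n u) + P (proj (n + 1) u) :=
    fun u n => rfl
  have hg0 : ∀ w, proj 0 (g w) = j w.1 + (proj 0 w.2 - P (proj 0 w.2)) := fun w => by
    simp [g, PP]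
  have hg1 : ∀ w n, proj (n + 1) (g w) =
      proj (n + 1) w.2 - P (proj (n + 1) w.2) + P (proj n w.2) := fun w n => by
    have := proj_single_ne (p := p) (X := fun _ : ℕ => U) n.succ_ne_zero (j w.1)
    simp only [Nat.succ_eq_add_one] at this
    simp [g, PP, this]
  refine ⟨⟨⟨f.toLinearMap, g, fun u => ?_, fun w => ?_⟩, f.continuous, g.continuous⟩⟩
  · change g (f u) = u
    refine LpSum.ext fun n => ?_
    cases n with
    | zero =>
      rw [hg0, hf1, hf2]
      simp only [map_add, map_sub, hPP]
      change P _ + _ = _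
      abel
    | succ n =>
      rw [hg1, hf2, hf2]
      simp only [map_add, map_sub, hPP]
      abel
  · change f (g w) = w
    refine Prod.ext ?_ (LpSum.ext fun n => ?_)
    · rw [hf1, hg0]
      simp only [map_add, map_sub, hqP, hqj]
      abel
    · rw [hf2]
      cases n with
      | zero =>
        rw [hg0, hg1]
        simp only [map_add, map_sub, hPP, hPj]
        abel
      | succ n =>
        rw [hg1, hg1]
        simp only [map_add, map_sub, hPP]
        abel

/-- The decomposition method: a space `X` which is complemented in `U`, and in which `ℓ_p(U)` is
complemented, is isomorphic to `ℓ_p(U)`. -/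
theorem isomorphic_lpSum_of_isComplementedIn [IsTopologicalAddGroup V]
    (h : IsComplementedIn V U) (h' : IsComplementedIn (LpSum p fun _ : ℕ => U) V) :
    Isomorphic V (LpSum p fun _ : ℕ => U) := by
  obtain ⟨e⟩ := h.isomorphic_prod (p := p)
  obtain ⟨e'⟩ := (h'.trans h).isomorphic_prod (p := p)
  obtain ⟨j, q, hqj⟩ := h'
  -- With `K = ker q` and `ℓ = ℓ_p(U)`, the chain is `V ≃ ℓ ⊕ K ≃ (ℓ ⊕ ℓ) ⊕ K ≃ ℓ ⊕ V ≃ V ⊕ ℓ ≃ ℓ`.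
  let d := ContinuousLinearEquiv.equivOfRightInverse q j hqj
  exact ⟨d.trans <| (e'.prodCongr (.refl ℝ _)).trans <|
    (ContinuousLinearEquiv.prodAssoc ℝ _ _ _).trans <|
    ((ContinuousLinearEquiv.refl ℝ _).prodCongr d.symm).trans <|
    (ContinuousLinearEquiv.prodComm ℝ _ _).trans e.symm⟩

variable {W : Type*} [NormedAddCommGroup W] [Module ℝ W] [PHomogeneous p W]

theorem IsComplementedIn.lpSum (h : IsComplementedIn W U) {ι : Type*} :
    IsComplementedIn (LpSum p fun _ : ι => W) (LpSum p fun _ : ι => U) := by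
  obtain ⟨j, q, hqj⟩ := h
  exact ⟨map j, map q, fun x => LpSum.ext fun n => by simp [hqj]⟩

end

/-! ### The universal property of Lipschitz free `p`-spaces -/

namespace Molecules

variable {p : ℝ} {X : Type*}

/-- The linear map on molecules induced by a map into a vector space. -/
def lift {Y : Type*} [AddCommGroup Y] [Module ℝ Y] (g : X → Y) : Molecules p X →ₗ[ℝ] Y :=
  (Finsupp.linearCombination ℝ g).comp (moleculeSubmodule X).subtype

theorem lift_diff {Y : Type*} [AddCommGroup Y] [Module ℝ Y] (g : X → Y) (x y : X) :
    lift g (diff p x y) = g x - g y := by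
  change Finsupp.linearCombination ℝ g (Finsupp.single x 1 - Finsupp.single y 1) = _
  simp

/-- The free norm is the largest admissible functional, and `C⁻¹` times the norm pulled back along
`lift g` is admissible. Here `C` is the `p`-th power of a Lipschitz constant. -/
theorem norm_lift_le [MetricSpace X] [Fact (p ∈ Ioc (0 : ℝ) 1)] {Y : Type*}
    [SeminormedAddCommGroup Y] [Module ℝ Y] [PHomogeneous p Y] {g : X → Y} {C : ℝ} (hC : 0 < C)
    (hg : ∀ x y, ‖g x - g y‖ ≤ C * dist x y ^ p) (m : Molecules p X) :
    ‖lift g m‖ ≤ C * ‖m‖ := by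
  have h : Admissible fun m : Molecules p X => C⁻¹ * ‖lift g m‖ :=
    { add_le := fun m n => by
        rw [← mul_add, map_add]
        gcongr
        exact norm_add_le _ _
      smul_eq := fun a m => by
        rw [map_smul, PHomogeneous.norm_smul_eq (p := p)]
        ring
      diff_le := fun x y => by
        rw [lift_diff, inv_mul_le_iff₀ hC]
        exact hg x y }
  have := le_freeNorm h m
  rwa [inv_mul_le_iff₀ hC] at this

theorem diff_add_diff (x y z : X) : diff p x y + diff p y z = diff p x z := by
  refine Subtype.ext ?_
  change (Finsupp.single x 1 - Finsupp.single y 1) + (Finsupp.single y 1 - Finsupp.single z 1) =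
    (Finsupp.single x 1 - Finsupp.single z 1 : X →₀ ℝ)
  abel

end Molecules

namespace LipschitzFree

variable {p : ℝ} [Fact (p ∈ Ioc (0 : ℝ) 1)] {X : Type*} [MetricSpace X]

/-- The inclusion of the molecules. -/
def ofMolecule : Molecules p X →ₗ[ℝ] LipschitzFree p X where
  toFun m := (m : UniformSpace.Completion (Molecules p X))
  map_add' := UniformSpace.Completion.coe_add
  map_smul' := UniformSpace.Completion.coe_smul

theorem norm_ofMolecule (m : Molecules p X) : ‖ofMolecule m‖ = ‖m‖ :=
  UniformSpace.Completion.norm_coe m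

theorem denseRange_ofMolecule : DenseRange (ofMolecule : Molecules p X → LipschitzFree p X) :=
  UniformSpace.Completion.denseRange_coe

variable (p) in
/-- The difference `δ x - δ y` of evaluations. -/
def diff (x y : X) : LipschitzFree p X := ofMolecule (Molecules.diff p x y)

theorem norm_diff_le (x y : X) : ‖diff p x y‖ ≤ dist x y ^ p := by
  rw [diff, norm_ofMolecule]
  exact Molecules.admissible_freeNorm.diff_le x y

theorem diff_add_diff (x y z : X) : diff p x y + diff p y z = diff p x z := by
  simp only [diff]
  rw [← map_add, Molecules.diff_add_diff]

@[simp]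
theorem diff_self (x : X) : diff p x x = 0 := by
  simpa using diff_add_diff (p := p) x x x

@[simp]
theorem diff_sub_diff_left (x y z : X) : diff p x z - diff p y z = diff p x y := by
  rw [← diff_add_diff x y z, add_sub_cancel_right]

theorem clm_ext {Z : Type*} [TopologicalSpace Z] [T2Space Z] [AddCommGroup Z] [Module ℝ Z]
    {S T : LipschitzFree p X →L[ℝ] Z} (h : ∀ x y, S (diff p x y) = T (diff p x y)) : S = T := by
  refine DFunLike.coe_injective <| denseRange_ofMolecule.equalizer S.continuous T.continuous ?_
  funext m
  rcases isEmpty_or_nonempty X with hX | ⟨⟨o⟩⟩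
  · have : m = 0 := Molecules.ext_apply fun x => (hX.false x).elim
    simp [this]
  · simp only [Function.comp_apply]
    rw [Molecules.eq_sum_diff m o]
    simp only [map_sum, map_smul]
    exact Finset.sum_congr rfl fun x _ => congrArg _ (h x o)

section lift

variable {Y : Type*} [NormedAddCommGroup Y] [Module ℝ Y] [PHomogeneous p Y] [CompleteSpace Y]

theorem exists_lift (g : X → Y) {C : ℝ} (hC : 0 < C)
    (hg : ∀ x y, ‖g x - g y‖ ≤ C * dist x y ^ p) :
    ∃ T : LipschitzFree p X →L[ℝ] Y, (∀ x y, T (diff p x y) = g x - g y) ∧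
      ∀ z, ‖T z‖ ≤ C * ‖z‖ := by
  have hbd := Molecules.norm_lift_le hC hg
  have hcont : Continuous (Molecules.lift (p := p) g) :=
    AddMonoidHomClass.continuous_of_bound (Molecules.lift (p := p) g) C hbd
  let E : LipschitzFree p X →+ Y :=
    AddMonoidHom.extension (Molecules.lift (p := p) g).toAddMonoidHom hcont
  have hE : Continuous E :=
    AddMonoidHom.continuous_extension (Molecules.lift (p := p) g).toAddMonoidHom hcont
  have hEm : ∀ m, E (ofMolecule m) = Molecules.lift g m := fun m =>
    AddMonoidHom.extension_coe (Molecules.lift (p := p) g).toAddMonoidHom hcont m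
  have h1 := PHomogeneous.uniformContinuousConstSMul p Y
  have h2 := PHomogeneous.uniformContinuousConstSMul p (LipschitzFree p X)
  let L : LipschitzFree p X →ₗ[ℝ] Y :=
    { toFun := E
      map_add' := map_add E
      map_smul' := fun a z => by
        refine denseRange_ofMolecule.induction_on (p := fun z => E (a • z) = a • E z) z
          (isClosed_eq (hE.comp (continuous_const_smul a)) (hE.const_smul a)) fun m => ?_
        rw [← map_smul, hEm, hEm, map_smul] }
  refine ⟨⟨L, hE⟩, fun x y => ?_, fun z => ?_⟩
  · exact (hEm _).trans (Molecules.lift_diff g x y)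
  · refine denseRange_ofMolecule.induction_on (p := fun z => ‖E z‖ ≤ C * ‖z‖) z
      (isClosed_le hE.norm (continuous_const.mul continuous_norm)) fun m => ?_
    rw [hEm, norm_ofMolecule]
    exact hbd m

/-- The continuous linear map on the Lipschitz free `p`-space that extends a Lipschitz map. -/
def lift (g : X → Y) {C : ℝ} (hC : 0 < C) (hg : ∀ x y, ‖g x - g y‖ ≤ C * dist x y ^ p) :
    LipschitzFree p X →L[ℝ] Y :=
  (exists_lift g hC hg).choose

@[simp]
theorem lift_diff (g : X → Y) {C : ℝ} (hC : 0 < C)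
    (hg : ∀ x y, ‖g x - g y‖ ≤ C * dist x y ^ p) (x y : X) :
    lift g hC hg (diff p x y) = g x - g y :=
  (exists_lift g hC hg).choose_spec.1 x y

theorem norm_lift_le (g : X → Y) {C : ℝ} (hC : 0 < C)
    (hg : ∀ x y, ‖g x - g y‖ ≤ C * dist x y ^ p) (z : LipschitzFree p X) :
    ‖lift g hC hg z‖ ≤ C * ‖z‖ :=
  (exists_lift g hC hg).choose_spec.2 z

end lift

theorem comp_eq_self {V : Type*} [TopologicalSpace V] [AddCommGroup V] [Module ℝ V]
    {A : LipschitzFree p X →L[ℝ] V} {B : V →L[ℝ] LipschitzFree p X}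
    (h : ∀ x y, B (A (diff p x y)) = diff p x y) (z : LipschitzFree p X) : B (A z) = z :=
  DFunLike.congr_fun (clm_ext (S := B.comp A) (T := .id ℝ _) h) z

theorem subsingleton [Subsingleton X] : Subsingleton (LipschitzFree p X) := by
  have h : (ContinuousLinearMap.id ℝ (LipschitzFree p X)) = 0 := clm_ext fun x y => by
    rw [Subsingleton.elim x y, diff_self, map_zero, map_zero]
  exact ⟨fun a b => (DFunLike.congr_fun h a).trans (DFunLike.congr_fun h b).symm⟩

end LipschitzFree

/-! ### Extension of Lipschitz maps from subsets of doubling spaces -/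

section Doubling

variable {M : Type*} [MetricSpace M]

theorem IsDoubling.exists_cover (hM : IsDoubling M) : ∃ D : ℕ, ∀ (n : ℕ) (x : M) (r : ℝ), 0 < r →
    ∃ t : Finset M, t.card ≤ D ^ n ∧
      Metric.closedBall x r ⊆ ⋃ y ∈ t, Metric.closedBall y (r / 2 ^ n) := by
  classical
  obtain ⟨D, hD⟩ := hM
  refine ⟨D, fun n => ?_⟩
  induction n with
  | zero => exact fun x r _ => ⟨{x}, by simp, by simp⟩
  | succ n ih =>
    intro x r hr
    obtain ⟨t, ht, hcov⟩ := ih x r hr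
    choose s hs hscov using fun y : M => hD y (r / 2 ^ n) (by positivity)
    refine ⟨t.biUnion s, ?_, fun z hz => ?_⟩
    · refine (Finset.card_biUnion_le_card_mul t s D fun y _ => hs y).trans ?_
      rw [pow_succ]
      gcongr
    · obtain ⟨y, hy, hzy⟩ := mem_iUnion₂.1 (hcov hz)
      obtain ⟨u, hu, hzu⟩ := mem_iUnion₂.1 (hscov y hzy)
      refine mem_iUnion₂.2 ⟨u, Finset.mem_biUnion.2 ⟨y, hy, hu⟩, ?_⟩
      rwa [pow_succ, ← div_div]

/-- In a doubling space, separated subsets of balls have boundedly many points. -/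
theorem IsDoubling.exists_card_le (hM : IsDoubling M) : ∃ K : ℕ, ∀ (x : M) (r : ℝ), 0 < r →
    ∀ E : Set M, E ⊆ Metric.closedBall x r → E.Pairwise (fun a b => r / 4 ≤ dist a b) →
      ∃ h : E.Finite, h.toFinset.card ≤ K := by
  obtain ⟨D, hD⟩ := hM.exists_cover
  refine ⟨D ^ 4, fun x r hr E hE hsep => ?_⟩
  -- Two points in the same ball of radius `r / 16` are at distance at most `r / 8 < r / 4`, so each
  -- of the `D ^ 4` balls contains at most one point of `E`.
  obtain ⟨t, ht, hcov⟩ := hD 4 x r hr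
  have hex : ∀ a ∈ E, ∃ y ∈ t, dist a y ≤ r / 2 ^ 4 := fun a ha => by
    simpa using hcov (hE ha)
  choose! c hct hc using hex
  have hinj : InjOn c E := fun a ha b hb hab => by
    by_contra hne
    have h1 := hsep ha hb hne
    have h2 := dist_triangle_right a b (c a)
    have h3 := hc a ha
    have h4 := hc b hb
    rw [← hab] at h4
    linarith
  have hmaps : MapsTo c E (t : Set M) := fun a ha => hct a ha
  have hfin : E.Finite := .of_injOn hmaps hinj t.finite_toSet
  refine ⟨hfin, le_trans ?_ ht⟩
  exact Finset.card_le_card_of_injOn c (by simpa using hmaps) (by simpa using hinj)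

theorem exists_maximal_pairwise {α : Type*} (s : Set α) (r : α → α → Prop)
    (hr : ∀ a b, r a b → r b a) :
    ∃ P ⊆ s, P.Pairwise r ∧ ∀ x ∈ s, x ∈ P ∨ ∃ y ∈ P, ¬ r x y := by
  obtain ⟨P, hP⟩ := zorn_subset {P : Set α | P ⊆ s ∧ P.Pairwise r} fun c hc hchain =>
    ⟨⋃₀ c, ⟨sUnion_subset fun P hP => (hc hP).1,
      (pairwise_sUnion hchain.directedOn).2 fun P hP => (hc hP).2⟩,
      fun P hP => subset_sUnion_of_mem hP⟩
  refine ⟨P, hP.prop.1, hP.prop.2, fun x hx => ?_⟩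
  by_contra! h
  refine h.1 (hP.le_of_ge (y := insert x P) ⟨insert_subset hx hP.prop.1, ?_⟩ (subset_insert _ _)
    (mem_insert _ _))
  exact hP.prop.2.insert fun y hy _ => ⟨h.2 y hy, hr _ _ (h.2 y hy)⟩

/-- A Lipschitz partition of unity on the complement of a subset of a doubling space, of bounded
multiplicity and subordinate to a Whitney cover. -/
theorem IsDoubling.exists_whitney_partition (hM : IsDoubling M) :
    ∃ (K : ℕ) (C : ℝ), 0 < C ∧ ∀ A : Set M, ∃ (w : M → M → ℝ) (J : M → Finset M),
      (∀ x, (J x).card ≤ K) ∧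
      (∀ x, 0 < Metric.infDist x A → ∑ i ∈ J x, w i x = 1) ∧
      (∀ i x, 0 ≤ w i x ∧ w i x ≤ 1) ∧
      (∀ i x, i ∉ J x → w i x = 0) ∧
      (∀ i x, i ∈ J x → dist x i ≤ Metric.infDist x A / 2) ∧
      ∀ x y, dist x y < Metric.infDist x A / 4 →
        ∀ i, |w i x - w i y| ≤ C * dist x y / Metric.infDist x A := by
  classical
  obtain ⟨K, hK⟩ := hM.exists_card_le
  -- The constant is `4 * (3 / 2 + 3 * K)`: `3 / 2` for a single bump, `3 * K` for the sum of the
  -- bumps, and `4` from the lower bound `ρ x / 4` for that sum.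
  refine ⟨K, 6 + 12 * K, by positivity, fun A => ?_⟩
  set ρ : M → ℝ := fun x => Metric.infDist x A with hρ
  have hρ0 : ∀ x, 0 ≤ ρ x := fun x => Metric.infDist_nonneg
  have hρ1 : ∀ x y, ρ x ≤ ρ y + dist x y := fun x y => Metric.infDist_le_infDist_add_dist
  obtain ⟨P, hPs, hPsep, hPmax⟩ := exists_maximal_pairwise {x | 0 < ρ x}
    (fun a b => min (ρ a) (ρ b) / 4 ≤ dist a b) fun a b h => by rwa [min_comm, dist_comm]
  -- The radius of the bump is measured at `x` rather than at the centre `i`; this keeps `ψ i`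
  -- Lipschitz and makes its support scale with the distance to `A`.
  let ψ : M → M → ℝ := fun i x => if i ∈ P then max 0 (ρ x / 2 - dist x i) else 0
  have hψ0 : ∀ i x, 0 ≤ ψ i x := fun i x => by
    simp only [ψ]; split_ifs <;> simp
  have hψlip : ∀ i x y, |ψ i x - ψ i y| ≤ 3 / 2 * dist x y := fun i x y => by
    simp only [ψ]
    split_ifs
    · rw [max_comm, max_comm (0 : ℝ)]
      refine (abs_max_sub_max_le_abs _ _ _).trans ?_
      have h1 := hρ1 x y
      have h2 := hρ1 y x
      have h3 := dist_triangle x y i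
      have h4 := dist_triangle y x i
      rw [dist_comm y x] at h2 h4
      rw [abs_le]
      constructor <;> linarith
    · simp only [sub_self, abs_zero]
      positivity
  have hfin : ∀ x, ∃ J : Finset M, J.card ≤ K ∧ ∀ i, i ∈ J ↔ ψ i x ≠ 0 := by
    intro x
    rcases (hρ0 x).eq_or_lt with h0 | hpos
    · refine ⟨∅, by simp, fun i => ?_⟩
      have : ψ i x = 0 := by
        simp only [ψ, ← h0]
        split_ifs
        · exact max_eq_left (by linarith [dist_nonneg (x := x) (y := i)])
        · rfl
      simp [this]
    · have hsub : ∀ i, ψ i x ≠ 0 → i ∈ P ∧ dist x i < ρ x / 2 := fun i hi => by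
        by_cases hiP : i ∈ P
        · refine ⟨hiP, ?_⟩
          by_contra! hle
          exact hi (by simp only [ψ, if_pos hiP]; exact max_eq_left (by linarith))
        · exact (hi (by simp only [ψ, if_neg hiP])).elim
      obtain ⟨h, hc⟩ := hK x (ρ x / 2) (by positivity) {i | ψ i x ≠ 0}
        (fun i hi => by
          rw [Metric.mem_closedBall, dist_comm]
          exact (hsub i hi).2.le)
        fun i hi j hj hij => by
          have h1 := hPsep (hsub i hi).1 (hsub j hj).1 hij
          have h2 := (hsub i hi).2
          have h3 := (hsub j hj).2
          have h4 := hρ1 x i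
          have h5 := hρ1 x j
          -- Centres active at `x` lie in the ball of radius `ρ x / 2`, so `ρ` is at least `ρ x / 2`
          -- there and they are `(ρ x / 2) / 4`-separated, exactly the ratio in the counting lemma.
          have h6 : ρ x / 2 ≤ min (ρ i) (ρ j) := le_min (by linarith) (by linarith)
          linarith
      exact ⟨h.toFinset, hc, fun i => by simp⟩
  choose J hJK hJ using hfin
  let Ψ : M → ℝ := fun x => ∑ i ∈ J x, ψ i x
  have hΨ : ∀ x (s : Finset M), J x ⊆ s → Ψ x = ∑ i ∈ s, ψ i x := fun x s hs =>
    Finset.sum_subset hs fun i _ hi => by simpa [hJ] using hi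
  have hΨlip : ∀ x y, |Ψ x - Ψ y| ≤ 3 * K * dist x y := fun x y => by
    rw [hΨ x (J x ∪ J y) Finset.subset_union_left, hΨ y (J x ∪ J y) Finset.subset_union_right,
      ← Finset.sum_sub_distrib]
    refine (Finset.abs_sum_le_sum_abs _ _).trans <|
      (Finset.sum_le_card_nsmul _ _ _ fun i _ => hψlip i x y).trans ?_
    rw [nsmul_eq_mul]
    have h1 : ((J x ∪ J y).card : ℝ) ≤ 2 * K := by
      have := Finset.card_union_le (J x) (J y)
      have h1 := hJK x
      have h2 := hJK y
      exact_mod_cast (by omega : (J x ∪ J y).card ≤ 2 * K)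
    have := mul_le_mul_of_nonneg_right h1 (dist_nonneg (x := x) (y := y))
    linarith
  have hψΨ : ∀ i x, ψ i x ≤ Ψ x := fun i x => by
    by_cases hi : i ∈ J x
    · exact Finset.single_le_sum (f := fun i => ψ i x) (fun j _ => hψ0 j x) hi
    · rw [not_not.1 (mt (hJ x i).2 hi)]
      exact Finset.sum_nonneg fun j _ => hψ0 j x
  have hΨ0 : ∀ x, 0 ≤ Ψ x := fun x => Finset.sum_nonneg fun j _ => hψ0 j x
  -- Maximality of `P` gives a centre within `ρ x / 4` of `x`, and its bump alone is at least `ρ x /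
  -- 2 - ρ x / 4`.
  have hΨlow : ∀ x, 0 < ρ x → ρ x / 4 ≤ Ψ x := fun x hx => by
    obtain ⟨i, hiP, hi⟩ : ∃ i ∈ P, dist x i ≤ ρ x / 4 := by
      rcases hPmax x hx with h | ⟨y, hy, hxy⟩
      · exact ⟨x, h, by simp; positivity⟩
      · refine ⟨y, hy, ?_⟩
        have := min_le_left (ρ x) (ρ y)
        linarith
    refine le_trans ?_ (hψΨ i x)
    simp only [ψ, if_pos hiP]
    exact le_max_of_le_right (by linarith)
  refine ⟨fun i x => ψ i x / Ψ x, J, hJK, fun x hx => ?_, fun i x => ⟨?_, ?_⟩, fun i x hi => ?_,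
    fun i x hi => ?_, fun x y hxy i => ?_⟩
  · have := hΨlow x hx
    rw [← Finset.sum_div]
    exact div_self (lt_of_lt_of_le (div_pos hx four_pos) this).ne'
  · exact div_nonneg (hψ0 i x) (hΨ0 x)
  · exact div_le_one_of_le₀ (hψΨ i x) (hΨ0 x)
  · change ψ i x / Ψ x = 0
    rw [not_not.1 (mt (hJ x i).2 hi), zero_div]
  · have := (hJ x i).1 hi
    by_contra! hlt
    refine this ?_
    simp only [ψ]
    split_ifs
    · exact max_eq_left (by linarith)
    · rfl
  · have hx : 0 < ρ x := by linarith [dist_nonneg (x := x) (y := y)]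
    have hy : 0 < ρ y := by linarith [hρ1 x y]
    have hΨx : 0 < Ψ x := by linarith [hΨlow x hx]
    have hΨy : 0 < Ψ y := by linarith [hΨlow y hy]
    have hid : ψ i x / Ψ x - ψ i y / Ψ y =
        ((ψ i x - ψ i y) - ψ i y / Ψ y * (Ψ x - Ψ y)) / Ψ x := by
      field_simp
      ring
    have hle1 : |ψ i y / Ψ y| ≤ 1 := by
      rw [abs_of_nonneg (div_nonneg (hψ0 i y) hΨy.le)]
      exact div_le_one_of_le₀ (hψΨ i y) hΨy.le
    have hnum : |(ψ i x - ψ i y) - ψ i y / Ψ y * (Ψ x - Ψ y)| ≤ (3 / 2 + 3 * K) * dist x y := by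
      refine (abs_sub _ _).trans ?_
      rw [abs_mul]
      have h1 := hψlip i x y
      have h2 := mul_le_mul hle1 (hΨlip x y) (abs_nonneg _) zero_le_one
      linarith
    rw [hid, abs_div, abs_of_pos hΨx, div_le_div_iff₀ hΨx hx]
    calc _ ≤ (3 / 2 + 3 * K) * dist x y * ρ x := by gcongr
      _ ≤ (3 / 2 + 3 * K) * dist x y * (4 * Ψ x) := by
        gcongr
        linarith [hΨlow x hx]
      _ = _ := by ring

/-- A Lipschitz map into a complete space extends to a point of the closure of its domain. -/
theorem exists_extension_of_mem_closure {p : ℝ} (hp : 0 < p) {P Y : Type*} [NormedAddCommGroup Y]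
    [CompleteSpace Y] {g : P → M} {h : P → Y} (hgh : ∀ a b, ‖h a - h b‖ ≤ dist (g a) (g b) ^ p)
    {x : M} (hx : x ∈ closure (range g)) : ∃ y : Y, ∀ b, ‖y - h b‖ ≤ dist x (g b) ^ p := by
  have hex : ∀ n : ℕ, ∃ b, dist x (g b) < 1 / ((n : ℝ) + 1) := fun n => by
    obtain ⟨_, ⟨b, rfl⟩, hb⟩ := Metric.mem_closure_iff.1 hx (1 / ((n : ℝ) + 1)) (by positivity)
    exact ⟨b, hb⟩
  choose b hb using hex
  have hlim : Filter.Tendsto (fun n => g (b n)) Filter.atTop (nhds x) := by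
    rw [tendsto_iff_dist_tendsto_zero]
    refine squeeze_zero (fun _ => dist_nonneg) (fun n => ?_) tendsto_one_div_add_atTop_nhds_zero_nat
    rw [dist_comm]
    exact (hb n).le
  have hcau : CauchySeq fun n => h (b n) := by
    refine cauchySeq_of_le_tendsto_0 (fun N : ℕ => (2 * (1 / ((N : ℝ) + 1))) ^ p)
      (fun n m N hn hm => ?_) ?_
    · rw [dist_eq_norm]
      refine (hgh _ _).trans (Real.rpow_le_rpow dist_nonneg ?_ hp.le)
      have h1 := dist_triangle_left (g (b n)) (g (b m)) x
      have h2 := hb n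
      have h3 := hb m
      have h4 : 1 / ((n : ℝ) + 1) ≤ 1 / ((N : ℝ) + 1) := by gcongr
      have h5 : 1 / ((m : ℝ) + 1) ≤ 1 / ((N : ℝ) + 1) := by gcongr
      linarith
    · have := (tendsto_one_div_add_atTop_nhds_zero_nat (𝕜 := ℝ)).const_mul 2
      rw [mul_zero] at this
      have := this.rpow_const (p := p) (Or.inr hp.le)
      rwa [Real.zero_rpow hp.ne'] at this
  obtain ⟨y, hy⟩ := cauchySeq_tendsto_of_complete hcau
  refine ⟨y, fun c => ?_⟩
  refine le_of_tendsto_of_tendsto' (hy.sub_const (h c)).norm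
    ((hlim.dist tendsto_const_nhds).rpow_const (p := p) (Or.inr hp.le)) fun n => hgh _ _

/-- Lipschitz maps into complete `p`-normed spaces extend from subsets of doubling spaces. -/
theorem IsDoubling.exists_extension.{u} {M : Type u} [MetricSpace M] (hM : IsDoubling M) (p : ℝ)
    [hp : Fact (p ∈ Ioc (0 : ℝ) 1)] : ∃ C : ℝ, 0 < C ∧ ∀ {P Y : Type u} [NormedAddCommGroup Y]
      [Module ℝ Y] [PHomogeneous p Y] [CompleteSpace Y] (g : P → M) (h : P → Y),
      (∀ a b, ‖h a - h b‖ ≤ dist (g a) (g b) ^ p) →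
      ∃ H : M → Y, (∀ a, H (g a) = h a) ∧ ∀ x y, ‖H x - H y‖ ≤ C * dist x y ^ p := by
  classical
  have hp0 : 0 < p := hp.out.1
  obtain ⟨K, C, hC, hW⟩ := hM.exists_whitney_partition
  -- Each of the at most `K` terms of the average differs from a value `h b` by at most `(5 * dist x
  -- (g b)) ^ p`; the `1` serves points of the closure, where the bound holds without a factor.
  let C₁ : ℝ := K * 5 ^ p + 1
  refine ⟨2 * K * (7 * C) ^ p + 2 * C₁ * 6 ^ p, by positivity, fun {P Y} _ _ _ _ g h hgh => ?_⟩
  rcases isEmpty_or_nonempty P with hP | hP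
  · exact ⟨fun _ => 0, fun a => (hP.false a).elim, fun x y => by
      rw [sub_zero, norm_zero]; positivity⟩
  obtain ⟨w, J, hJK, hsum, hw01, hwJ, hJd, hlip⟩ := hW (range g)
  set ρ : M → ℝ := fun x => Metric.infDist x (range g) with hρ
  have hne : (range g).Nonempty := range_nonempty g
  have hρ0 : ∀ x, 0 ≤ ρ x := fun x => Metric.infDist_nonneg
  have hρ1 : ∀ x y, ρ x ≤ ρ y + dist x y := fun x y => Metric.infDist_le_infDist_add_dist
  have hρle : ∀ x b, ρ x ≤ dist x (g b) := fun x b =>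
    Metric.infDist_le_dist_of_mem (mem_range_self b)
  have hnear : ∀ x r, ρ x < r → ∃ b, dist x (g b) < r := fun x r hr => by
    obtain ⟨_, ⟨b, rfl⟩, hb⟩ := (Metric.infDist_lt_iff hne).1 hr
    exact ⟨b, hb⟩
  have hnear2 : ∀ x, ∃ b, 0 < ρ x → dist x (g b) < 2 * ρ x := fun x => by
    by_cases hx : 0 < ρ x
    · obtain ⟨b, hb⟩ := hnear x (2 * ρ x) (by linarith)
      exact ⟨b, fun _ => hb⟩
    · exact ⟨hP.some, fun h => (hx h).elim⟩
  choose c hc using hnear2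
  -- If `i` is active at `x`, then `ρ i ≤ 3 / 2 * ρ x`, so the chosen point is within `ρ x / 2 + 2 *
  -- (3 / 2 * ρ x)`.
  have hcJ : ∀ i x, 0 < ρ x → i ∈ J x → dist x (g (c i)) ≤ 7 / 2 * ρ x := fun i x hx hi => by
    have h1 := hJd i x hi
    have h2 := hρ1 x i
    have h3 := hρ1 i x
    have h4 := hc i (by linarith)
    have h5 := dist_triangle x i (g (c i))
    rw [dist_comm i x] at h3
    linarith
  have hclos : ∀ x, ∃ y : Y, ¬ 0 < ρ x → ∀ b, ‖y - h b‖ ≤ dist x (g b) ^ p := fun x => by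
    by_cases hx : 0 < ρ x
    · exact ⟨0, fun h => (h hx).elim⟩
    · obtain ⟨y, hy⟩ := exists_extension_of_mem_closure hp0 hgh
        ((Metric.mem_closure_iff_infDist_zero hne).2 (le_antisymm (not_lt.1 hx) (hρ0 x)))
      exact ⟨y, fun _ => hy⟩
  choose f hf using hclos
  -- The extension is a Whitney average off the closure of the domain and the limit of the given
  -- values on it.
  let F : M → Y := fun x => if 0 < ρ x then ∑ i ∈ J x, w i x • h (c i) else f x
  have hF : ∀ x, 0 < ρ x → ∀ (b : P) (s : Finset M), J x ⊆ s →
      F x - h b = ∑ i ∈ s, w i x • (h (c i) - h b) := fun x hx b s hs => by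
    rw [← Finset.sum_subset hs fun i _ hi => by rw [hwJ i x hi, zero_smul]]
    simp only [F, if_pos hx, smul_sub, Finset.sum_sub_distrib, ← Finset.sum_smul, hsum x hx,
      one_smul]
  have hFb : ∀ x b, ‖F x - h b‖ ≤ C₁ * dist x (g b) ^ p := fun x b => by
    by_cases hx : 0 < ρ x
    · rw [hF x hx b _ subset_rfl]
      refine (norm_sum_smul_le (p := p) _ _ _).trans ?_
      calc ∑ i ∈ J x, |w i x| ^ p * ‖h (c i) - h b‖
          ≤ ∑ i ∈ J x, 5 ^ p * dist x (g b) ^ p := by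
            refine Finset.sum_le_sum fun i hi => ?_
            have h1 : |w i x| ^ p ≤ 1 := Real.rpow_le_one (abs_nonneg _)
              (by rw [abs_of_nonneg (hw01 i x).1]; exact (hw01 i x).2) hp0.le
            have h2 : ‖h (c i) - h b‖ ≤ (5 * dist x (g b)) ^ p := by
              refine (hgh _ _).trans (Real.rpow_le_rpow dist_nonneg ?_ hp0.le)
              have := hcJ i x hx hi
              have := hρle x b
              have := dist_triangle_left (g (c i)) (g b) x
              linarith [dist_nonneg (x := x) (y := g b)]
            rw [← Real.mul_rpow (by norm_num) dist_nonneg]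
            exact (mul_le_mul h1 h2 (norm_nonneg _) zero_le_one).trans_eq (one_mul _)
        _ ≤ K * (5 ^ p * dist x (g b) ^ p) := by
            rw [Finset.sum_const, nsmul_eq_mul]
            have : ((J x).card : ℝ) ≤ K := by exact_mod_cast hJK x
            gcongr
        _ ≤ C₁ * dist x (g b) ^ p := by
            have : 0 ≤ dist x (g b) ^ p := by positivity
            simp only [C₁]
            linarith
    · simp only [F, if_neg hx]
      refine (hf x hx b).trans (le_mul_of_one_le_left (by positivity) ?_)
      simp only [C₁, le_add_iff_nonneg_left]
      positivity
  have hFnear : ∀ x y, dist x y < ρ x / 4 →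
      ‖F x - F y‖ ≤ 2 * K * (7 * C) ^ p * dist x y ^ p := fun x y hxy => by
    have hx : 0 < ρ x := by linarith [dist_nonneg (x := x) (y := y)]
    have hy : 0 < ρ y := by linarith [hρ1 x y]
    obtain ⟨b, hb⟩ := hnear x (2 * ρ x) (by linarith)
    -- The weights sum to one at both points, so any `h b` may be subtracted. With `b` near `x`, the
    -- differences `h (c i) - h b` have size `(7 * ρ x) ^ p`, which cancels the `1 / ρ x` in the
    -- Lipschitz bound of the weights.
    have hd : F x - F y = ∑ i ∈ J x ∪ J y, (w i x - w i y) • (h (c i) - h b) := by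
      rw [← sub_sub_sub_cancel_right _ _ (h b), hF x hx b _ Finset.subset_union_left,
        hF y hy b _ Finset.subset_union_right, ← Finset.sum_sub_distrib]
      simp only [sub_smul]
    rw [hd]
    refine (norm_sum_smul_le (p := p) _ _ _).trans <|
      (Finset.sum_le_card_nsmul _ _ ((7 * C) ^ p * dist x y ^ p) fun i hi => ?_).trans ?_
    · have h1 : |w i x - w i y| ^ p ≤ (C * dist x y / ρ x) ^ p :=
        Real.rpow_le_rpow (abs_nonneg _) (hlip x y hxy i) hp0.le
      have h2 : ‖h (c i) - h b‖ ≤ (7 * ρ x) ^ p := by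
        refine (hgh _ _).trans (Real.rpow_le_rpow dist_nonneg ?_ hp0.le)
        have h3 := dist_triangle_left (g (c i)) (g b) x
        rcases Finset.mem_union.1 hi with hi | hi
        · have := hcJ i x hx hi
          linarith
        · have := hcJ i y hy hi
          have h4 := hρ1 y x
          have := dist_triangle x y (g (c i))
          rw [dist_comm y x] at h4
          linarith
      refine (mul_le_mul h1 h2 (norm_nonneg _) (by positivity)).trans_eq ?_
      rw [← Real.mul_rpow (by positivity) (by positivity),
        ← Real.mul_rpow (by positivity) (by positivity)]
      congr 1
      field_simp
    · rw [nsmul_eq_mul, mul_assoc]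
      have h1 : ((J x ∪ J y).card : ℝ) ≤ 2 * K := by
        have := Finset.card_union_le (J x) (J y)
        have h1 := hJK x
        have h2 := hJK y
        exact_mod_cast (by omega : (J x ∪ J y).card ≤ 2 * K)
      gcongr
  have hC₁ : 0 < C₁ := by positivity
  refine ⟨F, fun a => ?_, fun x y => ?_⟩
  · have := hFb (g a) a
    rw [dist_self, Real.zero_rpow hp0.ne', mul_zero] at this
    exact sub_eq_zero.1 (norm_le_zero_iff.1 this)
  · rw [add_mul]
    have hpos1 : 0 ≤ 2 * K * (7 * C) ^ p * dist x y ^ p := by positivity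
    have hpos2 : 0 ≤ 2 * C₁ * 6 ^ p * dist x y ^ p := by positivity
    by_cases hx : dist x y < ρ x / 4
    · linarith [hFnear x y hx]
    by_cases hy : dist x y < ρ y / 4
    · have := hFnear y x (by rwa [dist_comm])
      rw [norm_sub_rev, dist_comm y x] at this
      linarith
    rcases eq_or_ne x y with rfl | hxy
    · rw [sub_self, norm_zero]
      linarith
    have hd : 0 < dist x y := dist_pos.2 hxy
    -- Now the domain is within `4 * dist x y` of both points, so both values of `F` are compared
    -- with one value `h b`.
    obtain ⟨b, hb⟩ := hnear x (5 * dist x y) (by linarith)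
    have h1 : ‖F x - h b‖ ≤ C₁ * (6 * dist x y) ^ p := (hFb x b).trans (by
      gcongr
      linarith)
    have h2 : ‖F y - h b‖ ≤ C₁ * (6 * dist x y) ^ p := (hFb y b).trans (by
      have := dist_triangle_left y (g b) x
      gcongr
      linarith)
    have h3 : ‖F x - F y‖ ≤ ‖F x - h b‖ + ‖F y - h b‖ := by
      rw [← sub_sub_sub_cancel_right (F x) (F y) (h b)]
      exact norm_sub_le _ _
    rw [Real.mul_rpow (by norm_num) hd.le] at h1 h2
    linarith

end Doubling

/-! ### Auxiliary maps on Lipschitz free `p`-spaces -/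

/-- Multiplying the values by `B ^ (-1 / p)` reduces to the bound `1`, so the extension constant `C`
does not depend on `B`. -/
theorem IsDoubling.exists_extension_of_bound.{u} {M : Type u} [MetricSpace M] (hM : IsDoubling M)
    (p : ℝ) [hp : Fact (p ∈ Ioc (0 : ℝ) 1)] : ∃ C : ℝ, 0 < C ∧ ∀ {P Y : Type u}
      [NormedAddCommGroup Y] [Module ℝ Y] [PHomogeneous p Y] [CompleteSpace Y] (g : P → M)
      (h : P → Y) (B : ℝ), 0 < B → (∀ a b, ‖h a - h b‖ ≤ B * dist (g a) (g b) ^ p) →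
      ∃ H : M → Y, (∀ a, H (g a) = h a) ∧ ∀ x y, ‖H x - H y‖ ≤ C * B * dist x y ^ p := by
  obtain ⟨C, hC, hext⟩ := hM.exists_extension p
  refine ⟨C, hC, fun {P Y} _ _ _ _ g h B hB hgh => ?_⟩
  set s : ℝ := B ^ p⁻¹ with hs
  have hs0 : 0 < s := by positivity
  have hsp : |s| ^ p = B := by
    rw [abs_of_pos hs0, hs, ← Real.rpow_mul hB.le, inv_mul_cancel₀ hp.out.1.ne', Real.rpow_one]
  have hsp' : |s⁻¹| ^ p = B⁻¹ := by
    rw [abs_inv, Real.inv_rpow (abs_nonneg _), hsp]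
  obtain ⟨H, hHg, hH⟩ := hext g (fun a => s⁻¹ • h a) fun a b => by
    rw [← smul_sub, PHomogeneous.norm_smul_eq (p := p), hsp', inv_mul_le_iff₀ hB]
    exact hgh a b
  refine ⟨fun x => s • H x, fun a => ?_, fun x y => ?_⟩
  · simp only [hHg]
    rw [smul_inv_smul₀ hs0.ne']
  · rw [← smul_sub, PHomogeneous.norm_smul_eq (p := p), hsp, mul_comm C, mul_assoc]
    exact mul_le_mul_of_nonneg_left (hH x y) hB.le

namespace LipschitzFree

variable {p : ℝ} [hp : Fact (p ∈ Ioc (0 : ℝ) 1)] {X : Type*} [MetricSpace X]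

theorem norm_smul_diff_le (t : ℝ) (x y : X) : ‖t • diff p x y‖ ≤ (|t| * dist x y) ^ p := by
  rw [PHomogeneous.norm_smul_eq (p := p), Real.mul_rpow (abs_nonneg _) dist_nonneg]
  gcongr
  exact norm_diff_le x y

variable (p) in
/-- The evaluation at `x`, for some choice of base point that does not depend on `x`. -/
def based (x : X) : LipschitzFree p X := diff p x (Classical.choice ⟨x⟩)

theorem based_sub_based (x y : X) : based p x - based p y = diff p x y :=
  diff_sub_diff_left _ _ _

theorem norm_smul_based_sub_le (t : ℝ) (x y : X) :
    ‖t • based p x - t • based p y‖ ≤ (|t| * dist x y) ^ p := by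
  rw [← smul_sub, based_sub_based]
  exact norm_smul_diff_le t x y

end LipschitzFree

open LipschitzFree

/-- Extending the evaluation map of `S` to all of `M` and linearizing gives a left inverse of the
canonical map `F_p(S) → F_p(M)`. For `p < 1` duality is not available for this. -/
theorem IsDoubling.exists_retraction {M : Type*} [MetricSpace M] (hM : IsDoubling M) (p : ℝ)
    [hp : Fact (p ∈ Ioc (0 : ℝ) 1)] (S : Set M) : ∃ r : LipschitzFree p M →L[ℝ] LipschitzFree p S,
      ∀ x y : S, r (diff p x.1 y.1) = diff p x y := by
  obtain ⟨C, hC, hext⟩ := hM.exists_extension p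
  obtain ⟨H, hHg, hH⟩ := hext (fun x : S => x.1) (fun x : S => based p x) fun x y => by
    rw [based_sub_based]
    exact norm_diff_le x y
  exact ⟨lift H hC hH, fun x y => by rw [lift_diff, hHg, hHg, based_sub_based]⟩

/-! ### Dilated annuli -/

/-- A set `S` which is, up to the base point, the union of the annuli
`{x | a R ^ k < d(o, x) ≤ b R ^ k}`, which overlap, in a pointed metric space with a dilation. -/
structure IsAnnularUnion {M : Type*} [MetricSpace M] (o : M) (R a b : ℝ) (S : Set M) : Prop where
  R_pos : 0 < R
  a_pos : 0 < a
  dilation : IsRClosed o R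
  subset : ∀ k : ℕ, annulus o (a * R ^ k) (b * R ^ k) ⊆ S
  -- In both cases the middle inequality says that consecutive annuli overlap, which leaves room for
  -- Lipschitz cutoffs, and the last clause that the annuli cover `S` except for `o`. The strict `a
  -- < dist o x` and the weak `dist o x ≤ b` match the half-open annuli.
  cases : (1 < R ∧ a * R < b ∧ ∀ x ∈ S, x ≠ o → a < dist o x) ∨
    (R < 1 ∧ a < b * R ∧ ∀ x ∈ S, dist o x ≤ b)

theorem exists_dilation {M : Type*} [MetricSpace M] {o : M} {R : ℝ} (h : IsRClosed o R) :
    ∃ f : ℕ → M → M, (∀ n x y, dist (f n x) (f n y) = R ^ n * dist x y) ∧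
      ∀ n x, dist o (f n x) = R ^ n * dist o x := by
  obtain ⟨f, hfo, hf⟩ := h
  have h1 : ∀ n x y, dist (f^[n] x) (f^[n] y) = R ^ n * dist x y := fun n x y => by
    induction n with
    | zero => simp
    | succ n ih => rw [Function.iterate_succ_apply', Function.iterate_succ_apply', hf, ih]; ring
  refine ⟨fun n => f^[n], h1, fun n x => ?_⟩
  have := h1 n o x
  rwa [Function.iterate_fixed hfo] at this

namespace IsAnnularUnion

variable {M : Type*} [MetricSpace M] {o : M} {R a b : ℝ} {S : Set M}

theorem a_lt_b (h : IsAnnularUnion o R a b S) : a < b := by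
  have := h.a_pos
  have := h.R_pos
  rcases h.cases with ⟨h1, h2, -⟩ | ⟨h1, h2, -⟩
  · nlinarith
  · have : 0 < b := pos_of_mul_pos_left (by linarith) h.R_pos.le
    nlinarith

theorem b_pos (h : IsAnnularUnion o R a b S) : 0 < b := h.a_pos.trans h.a_lt_b

theorem dilate_mem (h : IsAnnularUnion o R a b S) {f : ℕ → M → M}
    (hf : ∀ n x, dist o (f n x) = R ^ n * dist o x) {k m : ℕ} (hkm : k ≤ m) {x : M}
    (hx : x ∈ annulus o (a * R ^ k) (b * R ^ k)) :
    f (m - k) x ∈ annulus o (a * R ^ m) (b * R ^ m) := by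
  have hR := h.R_pos
  have hpow : R ^ m = R ^ (m - k) * R ^ k := by rw [← pow_add, Nat.sub_add_cancel hkm]
  change dist o (f (m - k) x) ∈ Ioc _ _
  obtain ⟨h1, h2⟩ : dist o x ∈ Ioc _ _ := hx
  rw [hf, hpow]
  have : 0 < R ^ (m - k) := by positivity
  constructor
  · calc a * (R ^ (m - k) * R ^ k) = R ^ (m - k) * (a * R ^ k) := by ring
      _ < _ := by gcongr
  · calc R ^ (m - k) * dist o x ≤ R ^ (m - k) * (b * R ^ k) := by gcongr
      _ = _ := by ring

theorem dist_le_of_mem {k : ℕ} {x y : M} (hx : x ∈ annulus o (a * R ^ k) (b * R ^ k))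
    (hy : y ∈ annulus o (a * R ^ k) (b * R ^ k)) : dist x y ≤ 2 * b * R ^ k := by
  have h1 : dist o x ≤ b * R ^ k := hx.2
  have h2 : dist o y ≤ b * R ^ k := hy.2
  linarith [dist_triangle_left x y o]

/-- Points in annuli far apart in the sequence are far apart. -/
theorem exists_gap (h : IsAnnularUnion o R a b S) : ∃ L : ℕ, 0 < L ∧ ∀ m n : ℕ, m + L ≤ n →
    ∀ x ∈ annulus o (a * R ^ m) (b * R ^ m), ∀ y ∈ annulus o (a * R ^ n) (b * R ^ n),
      dist o x ≤ 2 * dist x y ∧ dist o y ≤ 2 * dist x y := by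
  have ha := h.a_pos
  have hb := h.b_pos
  have hR := h.R_pos
  rcases h.cases with ⟨hR1, -, -⟩ | ⟨hR1, -, -⟩
  · obtain ⟨L, hL⟩ := pow_unbounded_of_one_lt (2 * b / a) hR1
    refine ⟨L + 1, L.succ_pos, fun m n hmn x hx y hy => ?_⟩
    have hx2 : dist o x ≤ b * R ^ m := hx.2
    have hy1 : a * R ^ n < dist o y := hy.1
    have h1 : R ^ m * R ^ L ≤ R ^ n := by
      rw [← pow_add]
      exact pow_le_pow_right₀ hR1.le (by omega)
    rw [div_lt_iff₀ ha] at hL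
    -- Thus `y` is at least twice as far from `o` as `x`, so `dist x y` is at least half of `dist o
    -- y`.
    have h2 : 2 * (b * R ^ m) ≤ a * R ^ n := by
      calc 2 * (b * R ^ m) = (2 * b) * R ^ m := by ring
        _ ≤ (R ^ L * a) * R ^ m := by gcongr
        _ = a * (R ^ m * R ^ L) := by ring
        _ ≤ _ := by gcongr
    have h3 := dist_triangle o x y
    have h4 : 0 ≤ dist o x := dist_nonneg
    constructor <;> linarith
  · obtain ⟨L, hL⟩ := exists_pow_lt_of_lt_one (div_pos ha (mul_pos two_pos hb)) hR1
    refine ⟨L + 1, L.succ_pos, fun m n hmn x hx y hy => ?_⟩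
    have hx1 : a * R ^ m < dist o x := hx.1
    have hy2 : dist o y ≤ b * R ^ n := hy.2
    have h1 : R ^ n ≤ R ^ m * R ^ L := by
      rw [← pow_add]
      exact pow_le_pow_of_le_one hR.le hR1.le (by omega)
    rw [lt_div_iff₀ (by positivity)] at hL
    have h2 : 2 * (b * R ^ n) ≤ a * R ^ m := by
      calc 2 * (b * R ^ n) ≤ 2 * (b * (R ^ m * R ^ L)) := by gcongr
        _ = (R ^ L * (2 * b)) * R ^ m := by ring
        _ ≤ _ := by gcongr
    have h3 := dist_triangle_right o x y
    have h4 : 0 ≤ dist o y := dist_nonneg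
    constructor <;> linarith

/-- A point lies in boundedly many annuli. -/
theorem exists_multiplicity (h : IsAnnularUnion o R a b S) : ∃ (L : ℕ) (J : M → Finset ℕ),
    (∀ x, (J x).card ≤ L) ∧ ∀ x, ∀ k ∉ J x, x ∉ annulus o (a * R ^ k) (b * R ^ k) := by
  classical
  obtain ⟨L, hL, hgap⟩ := h.exists_gap
  have hex : ∀ x, ∃ J : Finset ℕ, J.card ≤ L ∧
      ∀ k ∉ J, x ∉ annulus o (a * R ^ k) (b * R ^ k) := fun x => by
    by_cases hx : ∃ k : ℕ, x ∈ annulus o (a * R ^ k) (b * R ^ k)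
    · refine ⟨Finset.Ico (Nat.find hx) (Nat.find hx + L), by simp, fun k hk hxk => ?_⟩
      have hmin : Nat.find hx ≤ k := Nat.find_min' hx hxk
      rw [Finset.mem_Ico, not_and, not_lt] at hk
      have h1 := (hgap _ _ (hk hmin) x (Nat.find_spec hx) x hxk).1
      have h2 : a * R ^ k < dist o x := hxk.1
      have h3 : 0 < a * R ^ k := mul_pos h.a_pos (pow_pos h.R_pos k)
      rw [dist_self] at h1
      linarith
    · exact ⟨∅, by simp, fun k _ hk => hx ⟨k, hk⟩⟩
  choose J hJ hJ' using hex
  exact ⟨L, J, hJ, hJ'⟩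

section

variable (p : ℝ) [hp : Fact (p ∈ Ioc (0 : ℝ) 1)]

/-- The free spaces of the annuli are uniformly complemented in those of the later annuli. -/
theorem exists_isBoundedlyComplementedIn (h : IsAnnularUnion o R a b S) (hM : IsDoubling M) :
    ∃ B : ℝ, 0 ≤ B ∧ ∀ k m : ℕ, k ≤ m → IsBoundedlyComplementedIn 1 B
      (LipschitzFree p (annulus o (a * R ^ k) (b * R ^ k)))
      (LipschitzFree p (annulus o (a * R ^ m) (b * R ^ m))) := by
  obtain ⟨C, hC, hext⟩ := hM.exists_extension p
  obtain ⟨f, hf, hfo⟩ := exists_dilation h.dilation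
  refine ⟨C, hC.le, fun k m hkm => ?_⟩
  have hRn : 0 < R ^ (m - k) := pow_pos h.R_pos _
  -- On the dilated copy of the smaller annulus, undoing the dilation and multiplying by its factor
  -- is a `1`-Lipschitz map. Its extension yields the projection, with a bound that does not depend
  -- on `k` and `m`.
  obtain ⟨H, hHg, hH⟩ := hext (fun x : annulus o (a * R ^ k) (b * R ^ k) => f (m - k) x.1)
    (fun x => R ^ (m - k) • based p x) fun x y => by
      rw [hf]
      simpa [abs_of_pos hRn, Subtype.dist_eq] using norm_smul_based_sub_le (p := p) (R ^ (m - k)) x y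
  let F : annulus o (a * R ^ k) (b * R ^ k) → annulus o (a * R ^ m) (b * R ^ m) :=
    fun x => ⟨f (m - k) x.1, h.dilate_mem hfo hkm x.2⟩
  have hF : ∀ x y, dist (F x) (F y) = R ^ (m - k) * dist x y := fun x y => hf _ _ _
  let j := lift (p := p) (fun x => (R ^ (m - k))⁻¹ • based p (F x)) one_pos fun x y => by
    refine (norm_smul_based_sub_le _ _ _).trans_eq ?_
    rw [hF, abs_inv, abs_of_pos hRn, inv_mul_cancel_left₀ hRn.ne', one_mul]
  let q := lift (p := p) (fun y : annulus o (a * R ^ m) (b * R ^ m) => H y.1) hC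
    fun x y => hH _ _
  refine ⟨j.toLinearMap, q.toLinearMap, norm_lift_le _ _ _, norm_lift_le _ _ _,
    comp_eq_self (A := j) (B := q) fun x y => ?_⟩
  simp only [j, q, lift_diff]
  rw [← smul_sub, based_sub_based, map_smul, lift_diff]
  change _ • (H (f (m - k) x.1) - H (f (m - k) y.1)) = _
  rw [hHg, hHg, ← smul_sub, inv_smul_smul₀ hRn.ne', based_sub_based]

/-- The `ℓ_p`-sum of infinitely many copies of the free spaces of all annuli is complemented in
the free space of their union. -/
theorem isComplementedIn_free (h : IsAnnularUnion o R a b S) (hM : IsDoubling M) :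
    IsComplementedIn
      (LpSum p fun i : ℕ × ℕ => LipschitzFree p (annulus o (a * R ^ i.2) (b * R ^ i.2)))
      (LipschitzFree p S) := by
  classical
  have ha := h.a_pos
  have hb := h.b_pos
  have hR := h.R_pos
  have hp0 : 0 < p := hp.out.1
  obtain ⟨C, hC, hext⟩ := hM.exists_extension_of_bound p
  obtain ⟨f, hf, hfo⟩ := exists_dilation h.dilation
  obtain ⟨L, hL, hgap⟩ := h.exists_gap
  -- The copy `i` of the annulus of index `i.2` is moved to level `m i ≥ i.2`; the factor `L` puts
  -- distinct copies at levels at least `L` apart.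
  let m : ℕ × ℕ → ℕ := fun i => L * Nat.pair i.1 i.2
  have hm : ∀ i, i.2 ≤ m i := fun i =>
    (Nat.right_le_pair i.1 i.2).trans (Nat.le_mul_of_pos_left _ hL)
  have hsep : ∀ i i', i ≠ i' → m i + L ≤ m i' ∨ m i' + L ≤ m i := fun i i' hne => by
    have hne' : Nat.pair i.1 i.2 ≠ Nat.pair i'.1 i'.2 := fun heq =>
      hne (Prod.ext_iff.2 (Nat.pair_eq_pair.1 heq))
    rcases lt_or_gt_of_ne hne' with hlt | hlt
    · exact .inl (by simpa [m, mul_add] using Nat.mul_le_mul_left L hlt)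
    · exact .inr (by simpa [m, mul_add] using Nat.mul_le_mul_left L hlt)
  let A : ℕ × ℕ → Set M := fun i => annulus o (a * R ^ i.2) (b * R ^ i.2)
  have hmem : ∀ (i : ℕ × ℕ) (x : A i),
      f (m i - i.2) x.1 ∈ annulus o (a * R ^ m i) (b * R ^ m i) := fun i x =>
    h.dilate_mem hfo (hm i) x.2
  have hpos : ∀ i : ℕ × ℕ, 0 < R ^ (m i - i.2) := fun i => pow_pos hR _
  let g : (Σ i : ℕ × ℕ, A i) → M := fun x => f (m x.1 - x.1.2) x.2.1
  let e : (Σ i : ℕ × ℕ, A i) → LpSum p fun i : ℕ × ℕ => LipschitzFree p (A i) := fun x =>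
    LpSum.single x.1 (R ^ (m x.1 - x.1.2) • based p x.2)
  -- An annulus has diameter comparable to its distance from `o`, so `e x` is controlled by `dist o
  -- (g x)`.
  have hnorm : ∀ (x : Σ i : ℕ × ℕ, A i) (r : ℝ), dist o (g x) ≤ 2 * r →
      ‖e x‖ ≤ (4 * b / a) ^ p * r ^ p := fun x r hr => by
    have h0 : 0 ≤ r := by linarith [dist_nonneg (x := o) (y := g x)]
    rw [LpSum.norm_single (X := fun i : ℕ × ℕ => LipschitzFree p (A i)),
      ← Real.mul_rpow (by positivity) h0]
    refine (norm_smul_diff_le _ _ _).trans (Real.rpow_le_rpow (by positivity) ?_ hp0.le)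
    have h1 := dist_le_of_mem x.2.2 (Subtype.prop (Classical.choice ⟨x.2⟩ : A x.1))
    have h2 : a * R ^ m x.1 < dist o (g x) := (hmem x.1 x.2).1
    have h3 : R ^ m x.1 = R ^ (m x.1 - x.1.2) * R ^ x.1.2 := by
      rw [← pow_add, Nat.sub_add_cancel (hm _)]
    rw [abs_of_pos (hpos _), Subtype.dist_eq]
    calc _ ≤ R ^ (m x.1 - x.1.2) * (2 * b * R ^ x.1.2) := by gcongr
      _ = 2 * b / a * (a * R ^ m x.1) := by rw [h3]; field_simp
      _ ≤ 2 * b / a * (2 * r) :=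
        mul_le_mul_of_nonneg_left (h2.le.trans hr) (by positivity)
      _ = _ := by ring
  let B : ℝ := 1 + 2 * (4 * b / a) ^ p
  have hB : 0 < B := by positivity
  -- Within one copy `e` is `1`-Lipschitz by scaling. For different copies `‖e x‖` and `‖e y‖` are
  -- estimated separately, both distances to `o` being at most `2 * dist (g x) (g y)` by the gap.
  obtain ⟨H, hHg, hH⟩ := hext g e B hB fun x y => by
    have h0 : 0 ≤ dist (g x) (g y) ^ p := by positivity
    have h1 : 0 ≤ (4 * b / a) ^ p * dist (g x) (g y) ^ p := by positivity
    rw [add_mul, one_mul, mul_assoc]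
    by_cases hxy : x.1 = y.1
    · obtain ⟨i, x⟩ := x
      obtain ⟨i', y⟩ := y
      obtain rfl : i = i' := hxy
      have h2 : ‖e ⟨i, x⟩ - e ⟨i, y⟩‖ ≤ dist (g ⟨i, x⟩) (g ⟨i, y⟩) ^ p := by
        simp only [e, g]
        rw [← map_sub, LpSum.norm_single (X := fun i : ℕ × ℕ => LipschitzFree p (A i)), hf]
        simpa [abs_of_pos (hpos i), Subtype.dist_eq] using norm_smul_based_sub_le (p := p) (R ^ (m i - i.2)) x y
      linarith
    · have h2 : dist o (g x) ≤ 2 * dist (g x) (g y) ∧ dist o (g y) ≤ 2 * dist (g x) (g y) := by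
        rcases hsep _ _ hxy with hlt | hlt
        · exact hgap _ _ hlt _ (hmem _ _) _ (hmem _ _)
        · rw [and_comm, dist_comm (g x)]
          exact hgap _ _ hlt _ (hmem _ _) _ (hmem _ _)
      have h3 := norm_sub_le (e x) (e y)
      have h4 := hnorm x _ h2.1
      have h5 := hnorm y _ h2.2
      linarith
  let F : ∀ i : ℕ × ℕ, A i → S := fun i x => ⟨f (m i - i.2) x.1, h.subset _ (hmem i x)⟩
  have hF : ∀ i x y, dist (F i x) (F i y) = R ^ (m i - i.2) * dist x y := fun i x y => hf _ _ _
  let j : ∀ i : ℕ × ℕ, LipschitzFree p (A i) →L[ℝ] LipschitzFree p S := fun i =>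
    lift (fun x => (R ^ (m i - i.2))⁻¹ • based p (F i x)) one_pos fun x y => by
      refine (norm_smul_based_sub_le _ _ _).trans_eq ?_
      rw [hF, abs_inv, abs_of_pos (hpos i), inv_mul_cancel_left₀ (hpos i).ne', one_mul]
  let q : LipschitzFree p S →L[ℝ] LpSum p fun i : ℕ × ℕ => LipschitzFree p (A i) :=
    lift (fun x : S => H x.1) (mul_pos hC hB) fun x y => hH _ _
  refine ⟨LpSum.lift (fun i => (j i).toLinearMap) fun i x => norm_lift_le _ _ _ x, q,
    LpSum.comp_eq_of_single (.id ℝ _) fun i z => ?_⟩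
  rw [LpSum.lift_single]
  refine DFunLike.congr_fun (clm_ext (S := q.comp (j i)) 
    (T := LpSum.singleL (X := fun i : ℕ × ℕ => LipschitzFree p (A i)) i)
    fun x y => ?_) z
  simp only [ContinuousLinearMap.comp_apply, j, q, lift_diff]
  rw [← smul_sub, based_sub_based, map_smul, lift_diff]
  change _ • (H (g ⟨i, x⟩) - H (g ⟨i, y⟩)) = _
  rw [hHg, hHg]
  simp only [e]
  rw [← map_sub, ← smul_sub, based_sub_based, map_smul, inv_smul_smul₀ (hpos i).ne']
  rfl

end

end IsAnnularUnion

/-! ### A radial partition of unity -/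

/-- The retraction of the real line onto the unit interval. -/
def clampUnit (t : ℝ) : ℝ := max 0 (min 1 t)

theorem clampUnit_nonneg (t : ℝ) : 0 ≤ clampUnit t := le_max_left _ _

theorem clampUnit_le_one (t : ℝ) : clampUnit t ≤ 1 := max_le zero_le_one (min_le_left _ _)

theorem clampUnit_of_nonpos {t : ℝ} (h : t ≤ 0) : clampUnit t = 0 :=
  max_eq_left ((min_le_right _ _).trans h)

theorem clampUnit_of_one_le {t : ℝ} (h : 1 ≤ t) : clampUnit t = 1 := by
  rw [clampUnit, min_eq_left h, max_eq_right zero_le_one]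

theorem abs_clampUnit_sub_le (s t : ℝ) : |clampUnit s - clampUnit t| ≤ |s - t| := by
  unfold clampUnit
  rw [max_comm, max_comm (0 : ℝ), min_comm, min_comm (1 : ℝ)]
  exact (abs_max_sub_max_le_abs _ _ _).trans (abs_inf_sub_inf_le_abs _ _ _)

namespace IsAnnularUnion

variable {M : Type*} [MetricSpace M] {o : M} {R a b : ℝ} {S : Set M}

/-- The cutoff `η (k + 1)` passes between `0` and `1` inside the overlap of the annuli `k` and `k +
1`, whose width is comparable to `R ^ k`. Off the annulus `k`, consecutive cutoffs therefore agree,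
and their differences form the partition of unity. -/
theorem exists_cutoff (h : IsAnnularUnion o R a b S) : ∃ (C : ℝ) (η : ℕ → M → ℝ), 0 < C ∧
    (∀ k x, 0 ≤ η k x ∧ η k x ≤ 1) ∧
    (∀ k x y, |η k x - η k y| ≤ C / R ^ k * dist x y) ∧
    (∀ x ∈ S, ∀ k, x ∉ annulus o (a * R ^ k) (b * R ^ k) → η k x = η (k + 1) x) ∧
    ∀ x ∈ S, x ≠ o → η 0 x = 1 ∧ ∃ K, ∀ k ≥ K, η k x = 0 := by
  have ha := h.a_pos
  have hb := h.b_pos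
  have hab := h.a_lt_b
  have hR := h.R_pos
  have hd : ∀ x y, |dist o x - dist o y| ≤ dist x y := fun x y => by
    rw [dist_comm o x, dist_comm o y]
    exact abs_dist_sub_le x y o
  have hannulus : ∀ x (k : ℕ), x ∉ annulus o (a * R ^ k) (b * R ^ k) →
      dist o x / R ^ k ≤ a ∨ b < dist o x / R ^ k := fun x k hx => by
    rw [div_le_iff₀ (pow_pos hR k), lt_div_iff₀ (pow_pos hR k)]
    by_contra! hcon
    exact hx hcon
  rcases h.cases with ⟨hR1, hRab, hS⟩ | ⟨hR1, hRab, hS⟩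
  · have hδ : 0 < b / R - a := by
      rw [sub_pos, lt_div_iff₀ hR]
      exact hRab
    let η : ℕ → M → ℝ := fun k x => match k with
      -- The constant `1` would not do here: `S` may contain `o`, which lies in no annulus and where
      -- all later cutoffs vanish.
      | 0 => clampUnit (dist o x / a)
      | k + 1 => clampUnit ((dist o x / R ^ (k + 1) - a) / (b / R - a))
    refine ⟨1 / a + 1 / (b / R - a), η, by positivity, fun k x => ?_, fun k x y => ?_,
      fun x hx k hk => ?_, fun x hx hxo => ⟨?_, ?_⟩⟩
    · cases k <;> exact ⟨clampUnit_nonneg _, clampUnit_le_one _⟩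
    · cases k with
      | zero =>
        refine (abs_clampUnit_sub_le _ _).trans ?_
        rw [← sub_div, abs_div, abs_of_pos ha, pow_zero, div_one, add_mul, div_mul_eq_mul_div,
          one_mul]
        refine le_add_of_le_of_nonneg ?_ (by positivity)
        gcongr
        exact hd x y
      | succ k =>
        refine (abs_clampUnit_sub_le _ _).trans ?_
        have hpk : 0 < R ^ (k + 1) := pow_pos hR _
        rw [← sub_div, sub_sub_sub_cancel_right, ← sub_div, abs_div, abs_div, abs_of_pos hδ,
          abs_of_pos hpk, add_div, add_mul]
        refine le_add_of_nonneg_of_le (by positivity) ?_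
        rw [div_div, div_div, div_mul_eq_mul_div, one_mul, mul_comm (R ^ (k + 1))]
        gcongr
        exact hd x y
    · have h1 : dist o x / R ^ (k + 1) = dist o x / R ^ k / R := by rw [pow_succ, div_div]
      rcases hannulus x k hk with hle | hlt
      · have h2 : η (k + 1) x = 0 := clampUnit_of_nonpos <| div_nonpos_of_nonpos_of_nonneg (by
          rw [h1, sub_nonpos, div_le_iff₀ hR]
          nlinarith) hδ.le
        rw [h2]
        cases k with
        | zero =>
          have hxo : x = o := by
            by_contra hne
            have := hS x hx hne
            rw [pow_zero, div_one] at hle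
            linarith
          change clampUnit _ = 0
          rw [hxo, dist_self, zero_div]
          exact clampUnit_of_nonpos le_rfl
        | succ k =>
          exact clampUnit_of_nonpos <|
            div_nonpos_of_nonpos_of_nonneg (sub_nonpos.2 hle) hδ.le
      · have h2 : η (k + 1) x = 1 := clampUnit_of_one_le <| by
          rw [one_le_div hδ, h1]
          gcongr
        rw [h2]
        cases k with
        | zero =>
          refine clampUnit_of_one_le ?_
          rw [pow_zero, div_one] at hlt
          rw [one_le_div ha]
          linarith
        | succ k =>
          refine clampUnit_of_one_le ?_
          rw [one_le_div hδ]
          have : b / R ≤ b := div_le_self hb.le hR1.le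
          linarith
    · refine clampUnit_of_one_le ?_
      rw [one_le_div ha]
      exact (hS x hx hxo).le
    · obtain ⟨K, hK⟩ := pow_unbounded_of_one_lt (dist o x / a) hR1
      refine ⟨K + 1, fun k hk => ?_⟩
      obtain ⟨k, rfl⟩ : ∃ k', k = k' + 1 := ⟨k - 1, by omega⟩
      refine clampUnit_of_nonpos <| div_nonpos_of_nonpos_of_nonneg ?_ hδ.le
      have : R ^ K ≤ R ^ (k + 1) := pow_le_pow_right₀ hR1.le (by omega)
      rw [div_lt_iff₀ ha] at hK
      rw [sub_nonpos, div_le_iff₀ (pow_pos hR _)]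
      nlinarith
  · have hδ : 0 < b - a / R := by
      rw [sub_pos, div_lt_iff₀ hR]
      exact hRab
    let η : ℕ → M → ℝ := fun k x => match k with
      -- Here all cutoffs equal `1` at `o`, so the constant is consistent even if `o` lies in `S`.
      | 0 => 1
      | k + 1 => clampUnit ((b - dist o x / R ^ (k + 1)) / (b - a / R))
    refine ⟨1 / (b - a / R), η, by positivity, fun k x => ?_, fun k x y => ?_,
      fun x hx k hk => ?_, fun x hx hxo => ⟨rfl, ?_⟩⟩
    · cases k
      · exact ⟨zero_le_one, le_rfl⟩
      · exact ⟨clampUnit_nonneg _, clampUnit_le_one _⟩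
    · cases k with
      | zero =>
        change |(1 : ℝ) - 1| ≤ _
        rw [sub_self, abs_zero]
        positivity
      | succ k =>
        refine (abs_clampUnit_sub_le _ _).trans ?_
        have hpk : 0 < R ^ (k + 1) := pow_pos hR _
        rw [← sub_div, sub_sub_sub_cancel_left, ← sub_div, abs_div, abs_div, abs_of_pos hδ,
          abs_of_pos hpk, div_div, div_div, div_mul_eq_mul_div, one_mul, mul_comm (R ^ (k + 1)),
          dist_comm x y]
        gcongr
        exact hd y x
    · have h1 : dist o x / R ^ (k + 1) = dist o x / R ^ k / R := by rw [pow_succ, div_div]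
      rcases hannulus x k hk with hle | hlt
      · have h2 : η (k + 1) x = 1 := clampUnit_of_one_le <| by
          rw [one_le_div hδ, h1]
          gcongr
        rw [h2]
        cases k with
        | zero => rfl
        | succ k =>
          refine clampUnit_of_one_le ?_
          rw [one_le_div hδ]
          have : a ≤ a / R := le_div_self ha.le hR hR1.le
          linarith
      · have h2 : η (k + 1) x = 0 := clampUnit_of_nonpos <| div_nonpos_of_nonpos_of_nonneg (by
          rw [h1, sub_nonpos, le_div_iff₀ hR]
          nlinarith) hδ.le
        rw [h2]
        cases k with
        | zero =>
          rw [pow_zero, div_one] at hlt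
          exact absurd (hS x hx) (not_le.2 hlt)
        | succ k =>
          exact clampUnit_of_nonpos <|
            div_nonpos_of_nonpos_of_nonneg (sub_nonpos.2 hlt.le) hδ.le
    · have hxo' : 0 < dist o x := dist_pos.2 hxo.symm
      obtain ⟨K, hK⟩ := exists_pow_lt_of_lt_one (div_pos hxo' hb) hR1
      refine ⟨K + 1, fun k hk => ?_⟩
      obtain ⟨k, rfl⟩ : ∃ k', k = k' + 1 := ⟨k - 1, by omega⟩
      refine clampUnit_of_nonpos <| div_nonpos_of_nonpos_of_nonneg ?_ hδ.le
      have : R ^ (k + 1) ≤ R ^ K := pow_le_pow_of_le_one hR.le hR1.le (by omega)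
      rw [lt_div_iff₀ hb] at hK
      rw [sub_nonpos, le_div_iff₀ (pow_pos hR _)]
      nlinarith

/-- The weights `η k - η (k + 1)` telescope to `η 0 = 1` at every point of `S` other than `o`; at
`o` they all vanish. -/
theorem exists_weights (h : IsAnnularUnion o R a b S) : ∃ (C : ℝ) (w : ℕ → M → ℝ), 0 < C ∧
    (∀ k x, |w k x| ≤ 1) ∧
    (∀ k x y, |w k x - w k y| ≤ C / R ^ k * dist x y) ∧
    (∀ x ∈ S, ∀ k, x ∉ annulus o (a * R ^ k) (b * R ^ k) → w k x = 0) ∧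
    ∀ x ∈ S, x ≠ o → ∀ J : Finset ℕ, (∀ k ∉ J, x ∉ annulus o (a * R ^ k) (b * R ^ k)) →
      ∑ k ∈ J, w k x = 1 := by
  obtain ⟨C, η, hC, h01, hlip, hann, hsum⟩ := h.exists_cutoff
  have hR := h.R_pos
  have hw : ∀ x ∈ S, ∀ k, x ∉ annulus o (a * R ^ k) (b * R ^ k) → η k x - η (k + 1) x = 0 :=
    fun x hx k hk => sub_eq_zero.2 (hann x hx k hk)
  refine ⟨C + C / R, fun k x => η k x - η (k + 1) x, by positivity, fun k x => ?_,
    fun k x y => ?_, hw, fun x hx hxo J hJ => ?_⟩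
  · have h1 := h01 k x
    have h2 := h01 (k + 1) x
    rw [abs_le]
    constructor <;> linarith
  · have h1 := hlip k x y
    have h2 := hlip (k + 1) x y
    have h3 : C / R ^ (k + 1) = C / R / R ^ k := by
      rw [div_div, pow_succ, mul_comm]
    rw [sub_sub_sub_comm, add_div, add_mul, ← h3]
    exact (abs_sub _ _).trans (add_le_add h1 h2)
  · obtain ⟨h0, K, hK⟩ := hsum x hx hxo
    obtain ⟨K', hK'⟩ := J.exists_nat_subset_range
    have hsub : J ⊆ Finset.range (max K K') := hK'.trans fun k hk =>
      Finset.mem_range.2 ((Finset.mem_range.1 hk).trans_le (le_max_right _ _))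
    rw [Finset.sum_subset hsub fun k _ hk => hw x hx k (hJ k hk),
      Finset.sum_range_sub' (fun k => η k x), h0, hK _ (le_max_left _ _), sub_zero]

end IsAnnularUnion

/-- At most `2 * L` coordinates of `T x - T y` are nonzero, so a bound on each coordinate bounds the
whole sum. -/
theorem LpSum.exists_map_of_multiplicity {p : ℝ} {ι P : Type*} {X : ι → Type*}
    [∀ i, NormedAddCommGroup (X i)] [∀ i, Module ℝ (X i)] [∀ i, PHomogeneous p (X i)]
    (t : P → ∀ i, X i) {L : ℕ} (J : P → Finset ι) (hJ : ∀ x, (J x).card ≤ L)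
    (hJ0 : ∀ x, ∀ i ∉ J x, t x i = 0) (D : P → P → ℝ) (hD : ∀ x y, 0 ≤ D x y)
    (ht : ∀ x y i, ‖t x i - t y i‖ ≤ D x y) :
    ∃ T : P → LpSum p X, (∀ x i, proj i (T x) = t x i) ∧
      ∀ x y, ‖T x - T y‖ ≤ 2 * L * D x y := by
  classical
  refine ⟨fun x => mk (t x) (summable_of_ne_finset_zero (s := J x) fun i hi => by
    rw [hJ0 x i hi, norm_zero]), fun x i => rfl, fun x y => ?_⟩
  rw [← (hasSum_norm _).tsum_eq]
  simp only [map_sub, proj_mk]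
  rw [tsum_eq_sum (s := J x ∪ J y) fun i hi => by
    rw [Finset.mem_union, not_or] at hi
    rw [hJ0 x i hi.1, hJ0 y i hi.2, sub_zero, norm_zero]]
  refine (Finset.sum_le_card_nsmul _ _ _ fun i _ => ht x y i).trans ?_
  rw [nsmul_eq_mul]
  have h1 : ((J x ∪ J y).card : ℝ) ≤ 2 * L := by
    have := Finset.card_union_le (J x) (J y)
    have h1 := hJ x
    have h2 := hJ y
    exact_mod_cast (by omega : (J x ∪ J y).card ≤ 2 * L)
  exact mul_le_mul_of_nonneg_right h1 (hD x y)

namespace IsAnnularUnion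

variable {M : Type*} [MetricSpace M] {o : M} {R a b : ℝ} {S : Set M}

/-- The free space of a union of annuli is complemented in the sum of the free spaces of the
annuli and of an `ℓ_p`-space, which accounts for the base points of the annuli. -/
theorem free_isComplementedIn (p : ℝ) [hp : Fact (p ∈ Ioc (0 : ℝ) 1)]
    (h : IsAnnularUnion o R a b S) (hM : IsDoubling M) {Z : Type*} [MetricSpace Z] [Nontrivial Z] :
    IsComplementedIn (LipschitzFree p S)
      ((LpSum p fun k : ℕ => LipschitzFree p (annulus o (a * R ^ k) (b * R ^ k))) ×
        LpSum p fun _ : ℕ => LipschitzFree p Z) := by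
  classical
  have hb := h.b_pos
  have hR := h.R_pos
  have hp0 : 0 < p := hp.out.1
  -- Only the line spanned by `δ u - δ v` in `F_p(Z)` is used, as a copy of the scalars. Stating the
  -- result with `F_p(Z)` lets `Z` be an annulus later on.
  obtain ⟨u, v, huv⟩ := exists_pair_ne Z
  have hduv : 0 < dist u v := dist_pos.2 huv
  obtain ⟨r, hr⟩ := hM.exists_retraction p S
  obtain ⟨C, w, hC, hw1, hwlip, hw0, hwsum⟩ := h.exists_weights
  obtain ⟨L, J, hJL, hJ⟩ := h.exists_multiplicity
  let A : ℕ → Set M := fun k => annulus o (a * R ^ k) (b * R ^ k)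
  have hwJ : ∀ (x : S), ∀ k ∉ J x, w k x = 0 := fun x k hk => hw0 x x.2 k (hJ x k hk)
  have hwdist : ∀ k x y, |w k x - w k y| * R ^ k ≤ C * dist x y := fun k x y => by
    have := hwlip k x y
    rwa [div_mul_eq_mul_div, le_div_iff₀ (pow_pos hR k)] at this
  let e : ∀ k, M → LipschitzFree p (A k) := fun k x =>
    if hx : x ∈ A k then based p (⟨x, hx⟩ : A k) else 0
  have hew : ∀ k (s : ℝ) x, ‖s • e k x‖ ≤ (|s| * (2 * b * R ^ k)) ^ p := fun k s x => by
    by_cases hx : x ∈ A k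
    · simp only [e, dif_pos hx]
      refine (norm_smul_diff_le _ _ _).trans (Real.rpow_le_rpow (by positivity) ?_ hp0.le)
      gcongr
      have := dist_le_of_mem hx (Subtype.prop (Classical.choice ⟨⟨x, hx⟩⟩ : A k))
      exact this
    · simp only [e, dif_neg hx, smul_zero, norm_zero]
      positivity
  -- The weight varies at rate `C / R ^ k` while `e k y` has size `(2 * b * R ^ k) ^ p`, so the
  -- scale cancels.
  have hew' : ∀ k x y, ‖(w k x - w k y) • e k y‖ ≤ (2 * b * C) ^ p * dist x y ^ p := fun k x y => by
    refine (hew k _ y).trans ?_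
    rw [← Real.mul_rpow (by positivity) dist_nonneg]
    refine Real.rpow_le_rpow (by positivity) ?_ hp0.le
    calc _ = 2 * b * (|w k x - w k y| * R ^ k) := by ring
      _ ≤ 2 * b * (C * dist x y) := mul_le_mul_of_nonneg_left (hwdist k x y) (by positivity)
      _ = _ := by ring
  let B₁ : ℝ := 1 + (2 * b * C) ^ p
  have hB₁ : 0 < B₁ := by positivity
  obtain ⟨T₁, hT₁, hT₁lip⟩ := LpSum.exists_map_of_multiplicity (p := p)
    (fun (x : S) k => w k x • e k x) (fun x : S => J x) (fun x => hJL x)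
    (fun x k hk => by rw [hwJ x k hk, zero_smul]) (fun x y => B₁ * dist x y ^ p)
    (fun x y => by positivity) fun x y k => by
      have h0 : 0 ≤ dist x y ^ p := by positivity
      have h1 := hew' k x.1 y.1
      have h2 := hew' k y.1 x.1
      rw [dist_comm y.1, ← Subtype.dist_eq] at h2
      rw [← Subtype.dist_eq] at h1
      simp only [B₁, add_mul, one_mul]
      by_cases hx : x.1 ∈ A k
      · by_cases hy : y.1 ∈ A k
        -- This is the product rule. If one of the points is outside the annulus, its weight
        -- vanishes and only the variation of the weight remains.
        · have h3 : w k x • e k x - w k y • e k y =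
              w k x • diff p (⟨x, hx⟩ : A k) ⟨y, hy⟩ + (w k x - w k y) • e k y := by
            rw [sub_smul, ← based_sub_based, smul_sub]
            simp only [e, dif_pos hx, dif_pos hy]
            abel
          rw [h3]
          refine (norm_add_le _ _).trans (add_le_add ?_ h1)
          refine (norm_smul_diff_le _ _ _).trans (Real.rpow_le_rpow (by positivity) ?_ hp0.le)
          exact mul_le_of_le_one_left dist_nonneg (hw1 k x)
        · have h3 : w k x • e k x - w k y • e k y = - ((w k y - w k x) • e k x) := by
            rw [hw0 y y.2 k hy, zero_smul, zero_sub, sub_zero, neg_smul, neg_neg]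
          rw [h3, norm_neg]
          linarith
      · have h3 : w k x • e k x - w k y • e k y = (w k x - w k y) • e k y := by
          rw [hw0 x x.2 k hx, zero_smul, zero_sub, zero_sub, neg_smul]
        rw [h3]
        linarith
  let z : LipschitzFree p Z := diff p u v
  let B₂ : ℝ := C ^ p * ‖z‖ + 1
  have hB₂ : 0 < B₂ := by positivity
  obtain ⟨T₂, hT₂, hT₂lip⟩ := LpSum.exists_map_of_multiplicity (p := p)
    (fun (x : S) k => (w k x * R ^ k) • z) (fun x : S => J x) (fun x => hJL x)
    (fun x k hk => by rw [hwJ x k hk, zero_mul, zero_smul]) (fun x y => B₂ * dist x y ^ p)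
    (fun x y => by positivity) fun x y k => by
      have h0 : 0 ≤ dist x y ^ p := by positivity
      rw [← sub_smul, ← sub_mul, PHomogeneous.norm_smul_eq (p := p), abs_mul,
        abs_of_pos (pow_pos hR k)]
      have h1 : (|w k x - w k y| * R ^ k) ^ p ≤ C ^ p * dist x y ^ p := by
        rw [← Real.mul_rpow hC.le dist_nonneg]
        exact Real.rpow_le_rpow (by positivity) (hwdist k x y) hp0.le
      have h2 := mul_le_mul_of_nonneg_right h1 (norm_nonneg z)
      simp only [B₂, add_mul, one_mul]
      linarith
  -- For a nonempty annulus this is the very point used by `based`. The value `o` for an empty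
  -- annulus is harmless, since its weight vanishes on `S`.
  let d : ℕ → M := fun k => if hk : Nonempty (A k) then (Classical.choice hk : A k).1 else o
  have hdist_d : ∀ k, dist (d k) o ≤ b * R ^ k := fun k => by
    by_cases hk : Nonempty (A k)
    · simp only [d, dif_pos hk]
      rw [dist_comm]
      exact (Subtype.prop (Classical.choice hk : A k)).2
    · simp only [d, dif_neg hk, dist_self]
      positivity
  let q₁ : ∀ k, LipschitzFree p (A k) →L[ℝ] LipschitzFree p M := fun k =>
    lift (fun x : A k => diff p x.1 o) one_pos fun x y => by
      rw [diff_sub_diff_left, one_mul]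
      exact norm_diff_le _ _
  have hq₁ : ∀ k (x : S), q₁ k (w k x • e k x) = w k x • diff p x.1 (d k) := fun k x => by
    by_cases hx : x.1 ∈ A k
    · have hk : Nonempty (A k) := ⟨⟨x, hx⟩⟩
      simp only [e, d, dif_pos hx, dif_pos hk, map_smul]
      congr 1
      simp only [based, q₁, lift_diff]
      rw [diff_sub_diff_left]
    · rw [hw0 x x.2 k hx, zero_smul, zero_smul, map_zero]
  -- It sends `δ u - δ v` to `R ^ (-k)` times `δ (d k) - δ o`. The factor offsets both the `R ^ k`
  -- in `T₂` and the distance from `d k` to `o`, which makes the bound uniform in `k`.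
  let q₂ : ∀ k : ℕ, LipschitzFree p Z →L[ℝ] LipschitzFree p M := fun k =>
    lift (C := (b / dist u v) ^ p) (fun y : Z => (dist y v / dist u v * (R ^ k)⁻¹) • diff p (d k) o)
      (by positivity) fun y y' => by
        rw [← sub_smul]
        refine (norm_smul_diff_le _ _ _).trans ?_
        rw [← Real.mul_rpow (by positivity) dist_nonneg]
        refine Real.rpow_le_rpow (by positivity) ?_ hp0.le
        have hRk : 0 < R ^ k := pow_pos hR k
        rw [← sub_mul, ← sub_div, abs_mul, abs_div, abs_of_pos hduv, abs_inv, abs_of_pos hRk]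
        calc _ ≤ dist y y' / dist u v * (R ^ k)⁻¹ * (b * R ^ k) := by
              gcongr
              · exact abs_dist_sub_le y y' v
              · exact hdist_d k
          _ = _ := by field_simp
  have hq₂ : ∀ k (x : S), q₂ k ((w k x * R ^ k) • z) = w k x • diff p (d k) o := fun k x => by
    have hRk : R ^ k ≠ 0 := (pow_pos hR k).ne'
    simp only [q₂, z, map_smul, lift_diff]
    rw [div_self hduv.ne', dist_self, zero_div, zero_mul, zero_smul, sub_zero, one_mul, mul_smul,
      smul_inv_smul₀ hRk]
  let Q₁ := LpSum.lift (p := p) (fun k => (q₁ k).toLinearMap) (fun k x => norm_lift_le _ _ _ x)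
  let Q₂ := LpSum.lift (p := p) (X := fun _ : ℕ => LipschitzFree p Z)
    (fun k => (q₂ k).toLinearMap) (fun k x => norm_lift_le _ _ _ x)
  have hQ : ∀ x : S, Q₁ (T₁ x) + Q₂ (T₂ x) = diff p x.1 o := fun x => by
    have h1 : Q₁ (T₁ x) = ∑ k ∈ J x, w k x • diff p x.1 (d k) := by
      refine (LpSum.lift_apply _ _ _).trans ?_
      simp only [hT₁, ContinuousLinearMap.coe_coe, hq₁]
      exact tsum_eq_sum fun k hk => by rw [hwJ x k hk, zero_smul]
    have h2 : Q₂ (T₂ x) = ∑ k ∈ J x, w k x • diff p (d k) o := by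
      refine (LpSum.lift_apply _ _ _).trans ?_
      simp only [hT₂, ContinuousLinearMap.coe_coe, hq₂]
      exact tsum_eq_sum fun k hk => by rw [hwJ x k hk, zero_smul]
    rw [h1, h2, ← Finset.sum_add_distrib]
    simp only [← smul_add, diff_add_diff, ← Finset.sum_smul]
    -- At `o` the weights do not sum to one, but the vector they multiply is zero.
    by_cases hxo : x.1 = o
    · rw [hxo, LipschitzFree.diff_self, smul_zero]
    · rw [hwsum x x.2 hxo _ (hJ x), one_smul]
  let t₁ := lift (p := p) T₁ (C := 2 * L * B₁ + 1) (by positivity) fun x y =>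
    (hT₁lip x y).trans <| by
      have : 0 ≤ dist x y ^ p := by positivity
      rw [← mul_assoc, add_mul]
      linarith
  let t₂ := lift (p := p) T₂ (C := 2 * L * B₂ + 1) (by positivity) fun x y =>
    (hT₂lip x y).trans <| by
      have : 0 ≤ dist x y ^ p := by positivity
      rw [← mul_assoc, add_mul]
      linarith
  -- The maps `Q₁` and `Q₂` take values in `F_p(M)` because `o` need not lie in `S`; the retraction
  -- `r` then returns to `F_p(S)`.
  refine ⟨t₁.prod t₂, r.comp (Q₁.coprod Q₂), comp_eq_self fun x y => ?_⟩
  have h3 : (Q₁.coprod Q₂) (t₁.prod t₂ (diff p x y)) = diff p x.1 y.1 := by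
    simp only [ContinuousLinearMap.prod_apply, ContinuousLinearMap.coprod_apply, t₁, t₂, lift_diff,
      map_sub]
    rw [sub_add_sub_comm, hQ, hQ, diff_sub_diff_left]
  rw [ContinuousLinearMap.comp_apply, h3, hr]

end IsAnnularUnion

/-! ### Isomorphisms between sums of free spaces of annuli -/

theorem LpSum.subsingleton {p : ℝ} {ι : Type*} {X : ι → Type*} [∀ i, NormedAddCommGroup (X i)]
    [∀ i, Module ℝ (X i)] [∀ i, PHomogeneous p (X i)] (h : ∀ i, Subsingleton (X i)) :
    Subsingleton (LpSum p X) :=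
  ⟨fun _ _ => LpSum.ext fun _ => Subsingleton.elim _ _⟩

theorem IsComplementedIn.prod {X X' Y Y' : Type*} [TopologicalSpace X] [AddCommGroup X]
    [Module ℝ X] [TopologicalSpace X'] [AddCommGroup X'] [Module ℝ X'] [TopologicalSpace Y]
    [AddCommGroup Y] [Module ℝ Y] [TopologicalSpace Y'] [AddCommGroup Y'] [Module ℝ Y']
    (h : IsComplementedIn X X') (h' : IsComplementedIn Y Y') :
    IsComplementedIn (X × Y) (X' × Y') := by
  obtain ⟨j, q, h⟩ := h
  obtain ⟨j', q', h'⟩ := h'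
  exact ⟨j.prodMap j', q.prodMap q', fun x => Prod.ext (h _) (h' _)⟩

section

variable {p : ℝ} [hp : Fact (p ∈ Ioc (0 : ℝ) 1)]

theorem Isomorphic.lpSum {U V : Type*} [NormedAddCommGroup U] [Module ℝ U] [PHomogeneous p U]
    [NormedAddCommGroup V] [Module ℝ V] [PHomogeneous p V] (h : Isomorphic U V) {ι : Type*} :
    Isomorphic (LpSum p fun _ : ι => U) (LpSum p fun _ : ι => V) := by
  obtain ⟨e⟩ := h
  refine ⟨.equivOfInverse (LpSum.map (e : U →L[ℝ] V)) (LpSum.map (e.symm : V →L[ℝ] U))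
    (fun x => LpSum.ext fun i => ?_) (fun x => LpSum.ext fun i => ?_)⟩ <;> simp

theorem LipschitzFree.isomorphic_univ (M : Type*) [MetricSpace M] :
    Isomorphic (LipschitzFree p (univ : Set M)) (LipschitzFree p M) := by
  let A : LipschitzFree p (univ : Set M) →L[ℝ] LipschitzFree p M :=
    lift (fun x => based p x.1) one_pos fun x y => by
      rw [based_sub_based, one_mul]
      exact norm_diff_le _ _
  let B : LipschitzFree p M →L[ℝ] LipschitzFree p (univ : Set M) :=
    lift (fun x => based p ⟨x, mem_univ x⟩) one_pos fun x y => by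
      rw [based_sub_based, one_mul]
      exact norm_diff_le _ _
  exact ⟨.equivOfInverse A B
    (comp_eq_self fun x y => by simp only [A, B, lift_diff, based_sub_based])
    (comp_eq_self fun x y => by simp only [A, B, lift_diff, based_sub_based])⟩

end

theorem exists_strictMono_comp_of_not_bddAbove {N : Type*} {φ : N → ℕ}
    (hφ : ¬ BddAbove (range φ)) : ∃ ψ : ℕ → N, StrictMono (φ ∘ ψ) := by
  have hex : ∀ m, ∃ n, m < φ n := fun m => by
    by_contra! hcon
    exact hφ ⟨m, by rintro _ ⟨n, rfl⟩; exact hcon n⟩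
  choose g hg using hex
  let ψ : ℕ → N := fun n => n.rec (g 0) fun _ x => g (φ x)
  exact ⟨ψ, strictMono_nat_of_lt_succ fun n => hg (φ (ψ n))⟩

namespace IsAnnularUnion

variable {M : Type*} [MetricSpace M] {o : M} {R a b : ℝ} {S : Set M} (p : ℝ)
  [hp : Fact (p ∈ Ioc (0 : ℝ) 1)]

theorem sum_isComplementedIn (h : IsAnnularUnion o R a b S) (hM : IsDoubling M) {ι κ : Type*}
    {α : ι → ℕ} {β : κ → ℕ} {e : ι → κ} (he : Function.Injective e) (hαβ : ∀ i, α i ≤ β (e i)) :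
    IsComplementedIn
      (LpSum p fun i : ι => LipschitzFree p (annulus o (a * R ^ α i) (b * R ^ α i)))
      (LpSum p fun i : κ => LipschitzFree p (annulus o (a * R ^ β i) (b * R ^ β i))) := by
  obtain ⟨B, hB, hcompl⟩ := h.exists_isBoundedlyComplementedIn p hM
  exact LpSum.isComplementedIn_of_injective he hB fun i => hcompl _ _ (hαβ i)

/-- All three spaces, `F_p(S)`, `ℓ_p(F_p(S))` and the sum over `N`, are complemented in `W` and
contain `ℓ_p(W)` complemented, so each is isomorphic to `ℓ_p(W)`. -/
theorem isomorphic (h : IsAnnularUnion o R a b S) (hM : IsDoubling M)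
    (hnt : ∃ k : ℕ, (annulus o (a * R ^ k) (b * R ^ k)).Nontrivial) :
    Isomorphic (LpSum p fun _ : ℕ => LipschitzFree p S) (LipschitzFree p S) ∧
    ∀ {N : Type*} [Countable N] (φ : N → ℕ), ¬ BddAbove (range φ) →
      Isomorphic (LipschitzFree p S)
        (LpSum p fun n : N => LipschitzFree p (annulus o (a * R ^ φ n) (b * R ^ φ n))) := by
  obtain ⟨k₀, hk₀⟩ := hnt
  have := nontrivial_coe_sort.2 hk₀
  let W := LpSum p fun k : ℕ => LipschitzFree p (annulus o (a * R ^ k) (b * R ^ k))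
  let U := LpSum p fun i : ℕ × ℕ => LipschitzFree p (annulus o (a * R ^ i.2) (b * R ^ i.2))
  have hWU : IsComplementedIn (LpSum p fun _ : ℕ => W) U := LpSum.isComplementedIn_prod
  have hUW : IsComplementedIn U W :=
    h.sum_isComplementedIn p hM (α := fun i : ℕ × ℕ => i.2) (β := id)
      (e := fun i => Nat.pair i.1 i.2)
      (fun i i' hi => Prod.ext_iff.2 (Nat.pair_eq_pair.1 hi)) fun i => Nat.right_le_pair i.1 i.2
  have hWW : IsComplementedIn (LpSum p fun _ : ℕ => W) W := hWU.trans hUW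
  have hW : Isomorphic W (LpSum p fun _ : ℕ => W) :=
    isomorphic_lpSum_of_isComplementedIn (.refl W) hWW
  -- `W × W` is complemented in `W × ℓ_p(W) ≃ ℓ_p(W)`, which is complemented in `W`.
  have hprod : IsComplementedIn (W × W) W :=
    ((IsComplementedIn.refl W).prod hW.isComplementedIn).trans
      ((((IsComplementedIn.refl W).isomorphic_prod (p := p)).symm.isComplementedIn).trans hWW)
  -- One annulus with two points suffices as `Z`: its copies are placed in the annuli `k₀ + j`.
  have hSW : IsComplementedIn (LipschitzFree p S) W :=
    (h.free_isComplementedIn p hM (Z := annulus o (a * R ^ k₀) (b * R ^ k₀))).trans <|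
      ((IsComplementedIn.refl W).prod <|
        h.sum_isComplementedIn p hM (α := fun _ : ℕ => k₀) (β := id) (e := fun j => k₀ + j)
          (add_right_injective k₀) fun j => Nat.le_add_right _ _).trans hprod
  have hWS : IsComplementedIn (LpSum p fun _ : ℕ => W) (LipschitzFree p S) :=
    hWU.trans (h.isComplementedIn_free p hM)
  have hS : Isomorphic (LipschitzFree p S) (LpSum p fun _ : ℕ => W) :=
    isomorphic_lpSum_of_isComplementedIn hSW hWS
  refine ⟨?_, fun {N} _ φ hφ => ?_⟩
  · exact (isomorphic_lpSum_of_isComplementedIn (hSW.lpSum.trans hWW)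
      (hWS.trans isComplementedIn_lpSum)).trans hS.symm
  -- Unboundedness of `φ` gives a subfamily with strictly increasing indices, which dominate the
  -- identity and so have room for every copy `(i, k)`. Countability of `N` serves the opposite
  -- embedding, since `φ` may repeat values.
  · obtain ⟨ψ, hψ⟩ := exists_strictMono_comp_of_not_bddAbove hφ
    obtain ⟨enc, henc⟩ := exists_injective_nat N
    refine hS.trans (isomorphic_lpSum_of_isComplementedIn ?_ (hWU.trans ?_)).symm
    · exact h.sum_isComplementedIn p hM (α := φ) (β := id) (e := fun n => Nat.pair (enc n) (φ n))
        (fun n n' hn => henc (Nat.pair_eq_pair.1 hn).1) fun n => Nat.right_le_pair _ _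
    · exact h.sum_isComplementedIn p hM (α := fun i : ℕ × ℕ => i.2) (β := φ)
        (e := fun i => ψ (Nat.pair i.1 i.2))
        (fun i i' hi => Prod.ext_iff.2 (Nat.pair_eq_pair.1 (hψ.injective.of_comp hi)))
        fun i => (Nat.right_le_pair i.1 i.2).trans (hψ.le_apply)

/-- The annuli occur in types. Replacing the whole family `A` at once avoids rewriting `1 * R ^ k`
inside them. -/
theorem isomorphic_lpSum_annuli (h : IsAnnularUnion o R a b S) (hM : IsDoubling M)
    {A : ℕ → Set M} (hA : ∀ k, A k = annulus o (a * R ^ k) (b * R ^ k))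
    (hnt : ∃ k, (A k).Nontrivial) {N : Type*} [Countable N] {φ : N → ℕ}
    (hφ : ¬ BddAbove (range φ)) :
    Isomorphic (LipschitzFree p S) (LpSum p fun n : N => LipschitzFree p (A (φ n))) := by
  obtain rfl : A = fun k => annulus o (a * R ^ k) (b * R ^ k) := funext hA
  exact (h.isomorphic p hM hnt).2 φ hφ

end IsAnnularUnion

/-- If every point of `S` other than the base point lies with its dilation in an annulus of a
suitable decomposition of `S`, then `F_p(S)` is isomorphic to its `ℓ_p`-sum. -/
theorem isomorphic_lpSum_free {M : Type*} [MetricSpace M] (hM : IsDoubling M) (p : ℝ)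
    [hp : Fact (p ∈ Ioc (0 : ℝ) 1)] {o : M} {R : ℝ} (hR1 : R ≠ 1) (hf : IsRClosed o R) {S : Set M}
    (h : ∀ x ∈ S, x ≠ o → ∃ a b, IsAnnularUnion o R a b S ∧ dist o x ∈ Ioc a b ∧
      R * dist o x ∈ Ioc a b) :
    Isomorphic (LpSum p fun _ : ℕ => LipschitzFree p S) (LipschitzFree p S) := by
  by_cases hS : ∃ x ∈ S, x ≠ o
  · obtain ⟨x, hx, hxo⟩ := hS
    obtain ⟨a, b, hab, h1, h2⟩ := h x hx hxo
    obtain ⟨f, -, hf⟩ := exists_dilation hf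
    have hfx : dist o (f 1 x) = R * dist o x := by rw [hf, pow_one]
    -- The point `x` and its dilation both lie in the annulus of index `0` and differ because `R ≠
    -- 1`. As `a` and `b` may depend on `x`, no assumption on given annuli is needed.
    refine (IsAnnularUnion.isomorphic.{_, 0} p hab hM ⟨0, x, ?_, f 1 x, ?_, fun heq => ?_⟩).1
    · simpa [annulus] using h1
    · simpa [annulus, hfx] using h2
    · rw [← heq] at hfx
      have : 0 < dist o x := dist_pos.2 hxo.symm
      exact hR1 (mul_right_cancel₀ this.ne' (by rw [one_mul, ← hfx]))
  · push Not at hS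
    have : Subsingleton S := ⟨fun x y => Subtype.ext ((hS x x.2).trans (hS y y.2).symm)⟩
    have := LipschitzFree.subsingleton (p := p) (X := S)
    have := LpSum.subsingleton (p := p) (X := fun _ : ℕ => LipschitzFree p S) fun _ => this
    exact .of_subsingleton _ _

/-! ### The sets of the theorem as unions of dilated annuli -/

theorem isAnnularUnion_compl_closedBall {M : Type*} [MetricSpace M] {o : M} {R : ℝ} (hR : 1 < R)
    (hf : IsRClosed o R) {c : ℝ} (hc : R < c) :
    IsAnnularUnion o R 1 c (Metric.closedBall o 1)ᶜ where
  R_pos := by linarith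
  a_pos := one_pos
  dilation := hf
  subset k x hx := by
    have h1 : 1 * R ^ k < dist o x := hx.1
    have h2 : 1 ≤ R ^ k := one_le_pow₀ hR.le
    rw [mem_compl_iff, Metric.mem_closedBall, dist_comm]
    linarith
  cases := .inl ⟨hR, by linarith, fun x hx _ => by
    rwa [mem_compl_iff, Metric.mem_closedBall, dist_comm, not_le] at hx⟩

theorem isAnnularUnion_closedBall {M : Type*} [MetricSpace M] {o : M} {R : ℝ} (hR0 : 0 < R)
    (hR : R < 1) (hf : IsRClosed o R) {c : ℝ} (hc0 : 0 < c) (hc : c < R) :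
    IsAnnularUnion o R c 1 (Metric.closedBall o 1) where
  R_pos := hR0
  a_pos := hc0
  dilation := hf
  subset k x hx := by
    have h1 : dist o x ≤ 1 * R ^ k := hx.2
    have h2 : R ^ k ≤ 1 := pow_le_one₀ hR0.le hR.le
    rw [Metric.mem_closedBall, dist_comm]
    linarith
  cases := .inr ⟨hR, by linarith, fun x hx => by
    rwa [Metric.mem_closedBall, dist_comm] at hx⟩

theorem isAnnularUnion_univ_of_isUniformlySeparated {M : Type*} [MetricSpace M] {o : M} {R s : ℝ}
    (hs : 0 < s) (hsep : ∀ x y : M, x ≠ y → s ≤ dist x y) (hR : 1 < R) (hf : IsRClosed o R) {c : ℝ}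
    (hc : s / 2 * R < c) : IsAnnularUnion o R (s / 2) c univ where
  R_pos := by linarith
  a_pos := by positivity
  dilation := hf
  subset _ _ _ := mem_univ _
  cases := .inl ⟨hR, hc, fun x _ hx => by linarith [hsep o x hx.symm]⟩

theorem isAnnularUnion_univ_of_dist_le {M : Type*} [MetricSpace M] {o : M} {R b : ℝ}
    (hb : ∀ x, dist o x ≤ b) (hR0 : 0 < R) (hR : R < 1) (hf : IsRClosed o R) {c : ℝ} (hc0 : 0 < c)
    (hc : c < b * R) : IsAnnularUnion o R c b univ where
  R_pos := hR0
  a_pos := hc0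
  dilation := hf
  subset _ _ _ := mem_univ _
  cases := .inr ⟨hR, hc, fun x _ => hb x⟩

theorem isomorphic_free_lpSum_of_not_nontrivial {M : Type*} [MetricSpace M] (hM : ¬ Nontrivial M)
    (p : ℝ) [hp : Fact (p ∈ Ioc (0 : ℝ) 1)] (S : Set M) {N : Type*} (A : N → Set M) :
    Isomorphic (LipschitzFree p S) (LpSum p fun n => LipschitzFree p (A n)) := by
  have := not_nontrivial_iff_subsingleton.1 hM
  have := LipschitzFree.subsingleton (p := p) (X := S)
  have := LpSum.subsingleton (p := p) (X := fun n => LipschitzFree p (A n))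
    fun n => LipschitzFree.subsingleton
  exact .of_subsingleton _ _

theorem theorem5 (p : ℝ) [Fact (p ∈ Set.Ioc (0 : ℝ) 1)]
    {M : Type*} [MetricSpace M] (o : M) (hM : IsDoubling M)
    (R : ℝ) (hR : R ∈ Set.Ioo (0 : ℝ) 1 ∪ Set.Ioi 1) (hf : IsRClosed o R)
    {N : Type*} [Countable N] (φ : N → ℕ) (hφ : ¬ BddAbove (Set.range φ)) :
    (1 < R → ∀ c : ℝ, R < c →
      Isomorphic (LpSum p (fun _ : ℕ => LipschitzFree p ↥(Metric.closedBall o 1)ᶜ))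
          (LipschitzFree p ↥(Metric.closedBall o 1)ᶜ) ∧
      ((Nontrivial M → ∃ k : ℕ, (annulus o (R ^ k) (c * R ^ k)).Nontrivial) →
        Isomorphic (LipschitzFree p ↥(Metric.closedBall o 1)ᶜ)
          (LpSum p (fun n : N => LipschitzFree p ↥(annulus o (R ^ φ n) (c * R ^ φ n)))))) ∧
    (R < 1 → ∀ c : ℝ, 0 < c → c < R →
      Isomorphic (LpSum p (fun _ : ℕ => LipschitzFree p ↥(Metric.closedBall o 1)))
          (LipschitzFree p ↥(Metric.closedBall o 1)) ∧
      ((Nontrivial M → ∃ k : ℕ, (annulus o (c * R ^ k) (R ^ k)).Nontrivial) →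
        Isomorphic (LipschitzFree p ↥(Metric.closedBall o 1))
          (LpSum p (fun n : N => LipschitzFree p ↥(annulus o (c * R ^ φ n) (R ^ φ n)))))) ∧
    ((IsUniformlySeparated M ∧ 1 < R) ∨ (Bornology.IsBounded (Set.univ : Set M) ∧ R < 1) →
      Isomorphic (LipschitzFree p M) (LpSum p (fun _ : ℕ => LipschitzFree p M))) := by
  have hR0 : 0 < R := by
    rcases hR with h | h
    · exact h.1
    · exact one_pos.trans h
  have hRne : R ≠ 1 := by
    rcases hR with h | h
    · exact h.2.ne
    · exact (ne_of_gt h)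
  refine ⟨fun hR1 c hc => ⟨?_, fun hnt => ?_⟩, fun hR1 c hc0 hc => ⟨?_, fun hnt => ?_⟩, ?_⟩
  · refine isomorphic_lpSum_free hM p hRne hf fun x hx _ => ?_
    rw [mem_compl_iff, Metric.mem_closedBall, dist_comm, not_le] at hx
    -- The outer radius exceeds `R`, as the overlap requires, and is large enough to include both
    -- `dist o x` and `R * dist o x`.
    refine ⟨1, R * dist o x + R, isAnnularUnion_compl_closedBall hR1 hf (by nlinarith),
      ⟨hx, by nlinarith⟩, ⟨by nlinarith, by linarith⟩⟩
  · by_cases hM' : Nontrivial M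
    · exact (isAnnularUnion_compl_closedBall hR1 hf hc).isomorphic_lpSum_annuli p hM
        (A := fun k => annulus o (R ^ k) (c * R ^ k)) (fun k => by rw [one_mul]) (hnt hM') hφ
    · exact isomorphic_free_lpSum_of_not_nontrivial hM' p _ _
  · refine isomorphic_lpSum_free hM p hRne hf fun x hx hxo => ?_
    rw [Metric.mem_closedBall, dist_comm] at hx
    have hpos : 0 < dist o x := dist_pos.2 hxo.symm
    have hpos' : 0 < R * dist o x := mul_pos hR0 hpos
    have hle : R * dist o x ≤ R := mul_le_of_le_one_right hR0.le hx
    have hlt : R * dist o x ≤ dist o x := mul_le_of_le_one_left hpos.le hR1.le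
    -- Halving puts the inner radius strictly below `R * dist o x`, as the half-open annulus
    -- requires, and strictly below `R`.
    refine ⟨R * dist o x / 2, 1, isAnnularUnion_closedBall hR0 hR1 hf (by positivity)
      (by linarith), ⟨by linarith, hx⟩, ⟨by linarith, by linarith⟩⟩
  · by_cases hM' : Nontrivial M
    · exact (isAnnularUnion_closedBall hR0 hR1 hf hc0 hc).isomorphic_lpSum_annuli p hM
        (A := fun k => annulus o (c * R ^ k) (R ^ k)) (fun k => by rw [one_mul]) (hnt hM') hφ
    · exact isomorphic_free_lpSum_of_not_nontrivial hM' p _ _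
  · intro hcase
    have hM' := LipschitzFree.isomorphic_univ (p := p) M
    refine (hM'.lpSum.symm.trans (Isomorphic.trans ?_ hM')).symm
    refine isomorphic_lpSum_free hM p hRne hf fun x _ hxo => ?_
    have hpos : 0 < dist o x := dist_pos.2 hxo.symm
    rcases hcase with ⟨⟨s, hs, hsep⟩, hR1⟩ | ⟨hbd, hR1⟩
    · have hsx := hsep o x hxo.symm
      -- Distances from `o` are at least `s`, so the inner radius `s / 2` is strictly below all of
      -- them.
      refine ⟨s / 2, R * dist o x + s / 2 * R,
        isAnnularUnion_univ_of_isUniformlySeparated hs hsep hR1 hf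
          (lt_add_of_pos_left _ (by positivity)), ⟨by linarith, ?_⟩, ⟨?_, ?_⟩⟩
      · have : 0 < s / 2 * R := by positivity
        nlinarith
      · nlinarith
      · exact le_add_of_nonneg_right (by positivity)
    · obtain ⟨b, hb⟩ := hbd.subset_closedBall o
      have hb' : ∀ y, dist o y ≤ b := fun y => by
        rw [dist_comm]
        exact hb (mem_univ y)
      have hpos' : 0 < R * dist o x := mul_pos hR0 hpos
      have hlt : R * dist o x ≤ dist o x := mul_le_of_le_one_left hpos.le hR1.le
      have hle : R * dist o x ≤ b * R := by
        rw [mul_comm]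
        exact mul_le_mul_of_nonneg_right (hb' x) hR0.le
      exact ⟨R * dist o x / 2, b, isAnnularUnion_univ_of_dist_le hb' hR0 hR1 hf (by positivity)
        (by linarith), ⟨by linarith, hb' x⟩, ⟨by linarith, hlt.trans (hb' x)⟩⟩

end
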